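/- Let $a,\alpha,\beta>0$ and let $c_o\neq 0$, $b\neq 0$ be real numbers with $-3a\le b\le a$. For an immersed oriented disc $X:\Sigma\to\mathbb R^3$, where $\Sigma$ is a closed disc, $X$ is of class $C^4$ up to the boundary and $\nu$ is its unit normal, consider the Euler–Helfrich energy $$E[X]=\int_\Sigma\bigl(a(H+c_o)^2+bK\bigr)\,d\Sigma+\oint_{\partial\Sigma}(\alpha\kappa^2+\beta)\,ds .$$ Here $K$ is the Gaussian curvature, $\kappa$ is the curvature of the boundary curve in $\mathbb R^3$, and $H$ is the mean curvature, half the trace of the second fundamental form with respect to $\nu$, with the sign for which $\Delta X=2H\nu$ (so a round sphere of radius $R$ with outward normal has $H=-1/R$). The disc $X$ is called critical for $E$ if $\frac{d}{dt}\big|_{t=0}E[X+tV]=0$ for every $C^4$ map $V:\Sigma\to\mathbb R^3$, with no condition on $V$ along $\partial\Sigma$. It is called axially symmetric if, after a rigid motion, it has the form $(s,\theta)\mapsto(r(s)\cos\theta,r(s)\sin\theta,z(s))$ in polar coordinates $(s,\theta)$ of $\Sigma$. Suppose that $X$ is an axially symmetric immersed disc which is critical for $E$ and whose boundary is a circle of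 radius $\sqrt{\alpha/\beta}$. Then $X$ does not minimize $E$ among axially symmetric surfaces. More precisely, there is an axially symmetric spherical cap $Y$, of a sphere of radius $1/|c_o|$, oriented so that $H\equiv -c_o$ and bounded by a circle of radius $\sqrt{\alpha/\beta}$, with $E[Y]<E[X]$. -/

import Mathlib

open scoped Matrix

noncomputable section

namespace EulerHelfrich

/-- Euclidean three-space; inner product and cross product are `⬝ᵥ` and `⨯₃`. -/
abbrev R3 : Type := Fin 3 → ℝ

/-- The Euclidean length in `R3` (the instance norm of `Fin 3 → ℝ` is the sup norm and is not
used for lengths). -/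
def len (v : R3) : ℝ := √(v ⬝ᵥ v)

/-! ### Local geometry of a coordinate patch `X : (s, θ) ↦ X s θ` -/

section Patch

variable (X : ℝ → ℝ → R3) (s θ : ℝ)

/-- `X_s` -/
def d1 : R3 := deriv (fun x => X x θ) s

/-- `X_θ` -/
def d2 : R3 := deriv (fun y => X s y) θ

/-- `X_ss` -/
def d11 : R3 := d1 (d1 X) s θ

/-- `X_sθ` -/
def d12 : R3 := d2 (d1 X) s θ

/-- `X_θθ` -/
def d22 : R3 := d2 (d2 X) s θ

/-- The area density `|X_s × X_θ|`. -/
def areaDensity : ℝ := len (d1 X s θ ⨯₃ d2 X s θ)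

/-- The unit normal `ν = X_s × X_θ / |X_s × X_θ|`. -/
def unitNormal : R3 := (areaDensity X s θ)⁻¹ • (d1 X s θ ⨯₃ d2 X s θ)

/-- `E G - F²`, the determinant of the first fundamental form. -/
def firstDet : ℝ :=
  (d1 X s θ ⬝ᵥ d1 X s θ) * (d2 X s θ ⬝ᵥ d2 X s θ) - (d1 X s θ ⬝ᵥ d2 X s θ) ^ 2

/-- The mean curvature `H`, half the trace of the second fundamental form `X_ij · ν`
(so that `Δ X = 2 H ν`, and a round sphere of radius `R` with outward normal has `H = -1/R`). -/
def meanCurvature : ℝ :=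
  ((d11 X s θ ⬝ᵥ unitNormal X s θ) * (d2 X s θ ⬝ᵥ d2 X s θ)
    - 2 * (d12 X s θ ⬝ᵥ unitNormal X s θ) * (d1 X s θ ⬝ᵥ d2 X s θ)
    + (d22 X s θ ⬝ᵥ unitNormal X s θ) * (d1 X s θ ⬝ᵥ d1 X s θ)) / (2 * firstDet X s θ)

/-- The Gaussian curvature `K`. -/
def gaussCurvature : ℝ :=
  ((d11 X s θ ⬝ᵥ unitNormal X s θ) * (d22 X s θ ⬝ᵥ unitNormal X s θ)
    - (d12 X s θ ⬝ᵥ unitNormal X s θ) ^ 2) / firstDet X s θ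

end Patch

/-! ### Space curves -/

/-- The Frenet curvature `|C' × C''| / |C'|³` of a regular, not necessarily arc length
parametrized, space curve. -/
def curveCurvature (C : ℝ → R3) (t : ℝ) : ℝ :=
  len (deriv C t ⨯₃ deriv (deriv C) t) / len (deriv C t) ^ 3

/-! ### Immersed discs -/

/-- The closed unit disc of the parameter plane. -/
def disc : Set (ℝ × ℝ) := {p | p.1 ^ 2 + p.2 ^ 2 ≤ 1}

/-- `F` restricted to the closed unit disc is an immersion of class `C⁴` up to the boundary.
The values of `F` off the disc play no role. The orientation is the one of the plane. -/
structure IsImmersedDisc (F : ℝ × ℝ → R3) : Prop where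
  contDiff : ContDiff ℝ 4 F
  immersion : ∀ p ∈ disc, Function.Injective (fderiv ℝ F p)

/-- The surface `F` in polar coordinates of the parameter disc. -/
def polar (F : ℝ × ℝ → R3) (s θ : ℝ) : R3 := F (s * Real.cos θ, s * Real.sin θ)

/-- The boundary curve of the disc. -/
def boundaryCurve (F : ℝ × ℝ → R3) (θ : ℝ) : R3 := polar F 1 θ

/-- The Euler-Helfrich energy
`∫_Σ (a (H + c)² + b K) dΣ + ∮_∂Σ (α κ² + β) ds`
of the disc `F`. The integrals are written in polar coordinates of the parameter disc; the
centre `s = 0`, where these coordinates are singular, is a null set. -/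
def energy (a c b α β : ℝ) (F : ℝ × ℝ → R3) : ℝ :=
  (∫ θ in (0 : ℝ)..(2 * Real.pi), ∫ s in (0 : ℝ)..1,
      (a * (meanCurvature (polar F) s θ + c) ^ 2 + b * gaussCurvature (polar F) s θ)
        * areaDensity (polar F) s θ)
    + ∫ θ in (0 : ℝ)..(2 * Real.pi),
        (α * curveCurvature (boundaryCurve F) θ ^ 2 + β) * len (deriv (boundaryCurve F) θ)

/-- `F` is critical for the energy: its first variation vanishes for every variation field of
class `C⁴`, with no condition on the field at the boundary. -/
def IsCritical (a c b α β : ℝ) (F : ℝ × ℝ → R3) : Prop :=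
  ∀ V : ℝ × ℝ → R3, ContDiff ℝ 4 V →
    HasDerivAt (fun t : ℝ => energy a c b α β (fun p => F p + t • V p)) 0 0

/-- `F` is the disc obtained by rotating the profile curve `s ↦ (r s, z s)`, `0 ≤ s ≤ 1`, about an
axis. The rigid motion `x ↦ q + Q x` carries the third coordinate axis to the axis of rotation,
and `r s` is the distance to the axis. The profile need not be parametrized by arc length. -/
structure IsRevolutionDisc (F : ℝ × ℝ → R3) (Q : Matrix (Fin 3) (Fin 3) ℝ) (q : R3)
    (r z : ℝ → ℝ) : Prop where
  rotation : Q ∈ Matrix.specialOrthogonalGroup (Fin 3) ℝ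
  nonneg : ∀ s ∈ Set.Icc (0 : ℝ) 1, 0 ≤ r s
  eq_rotate : ∀ s ∈ Set.Icc (0 : ℝ) 1, ∀ θ : ℝ,
    polar F s θ = q + Q *ᵥ ![r s * Real.cos θ, r s * Real.sin θ, z s]

/-- `F` is an axially symmetric disc. -/
def IsAxiallySymmetric (F : ℝ × ℝ → R3) : Prop :=
  ∃ Q q r z, IsRevolutionDisc F Q q r z

/-- `F` is an axially symmetric disc whose boundary is a circle of radius `ρ` about the axis. -/
def IsAxiallySymmetricWithRadius (F : ℝ × ℝ → R3) (ρ : ℝ) : Prop :=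
  ∃ Q q r z, IsRevolutionDisc F Q q r z ∧ r 1 = ρ

/-- `F` minimizes the energy among the axially symmetric immersed discs. -/
def MinimizesAmongAxiallySymmetric (a c b α β : ℝ) (F : ℝ × ℝ → R3) : Prop :=
  ∀ G : ℝ × ℝ → R3, IsImmersedDisc G → IsAxiallySymmetric G →
    energy a c b α β F ≤ energy a c b α β G

/-- `F` parametrizes, injectively, a cap of a round sphere of radius `R`: the part of the sphere
on one side of a plane that meets it in a circle. -/
def IsSphericalCap (F : ℝ × ℝ → R3) (R : ℝ) : Prop :=
  Set.InjOn F disc ∧ ∃ (m u : R3) (h : ℝ), u ⬝ᵥ u = 1 ∧ -R < h ∧ h < R ∧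
    F '' disc = {x | (x - m) ⬝ᵥ (x - m) = R ^ 2 ∧ h ≤ (x - m) ⬝ᵥ u}

end EulerHelfrich

end

open Set Filter Topology

noncomputable section

namespace EulerHelfrich

/-! ### Invariance under rotations -/

/-! Write the profile as `(r, z)` with speed `w`, put `u = H + c`, and let `k₁`, `k₂` be the
curvatures of the meridian and of the parallels. At the rim let `ρ` be the radius and `CX = r'/w`,
`S = z'/w` the cosine and sine of the tangent angle. Gauss–Bonnet reduces the energy to `2π` times
the bending integral of `a u²`, plus `2πb(1 - CX)`, plus `2π(α/ρ + βρ)`. The radius `√(α/β)` is a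
critical point of `ρ ↦ α/ρ + βρ`, so the boundary length and curvature terms drop out of the first
variation.

Criticality is tested only on axially symmetric fields vanishing near the axis. Turning the profile
velocity at rate `f` and stretching it at rate `g` gives two Euler–Lagrange equations. The radius
depends on these rates by integration, which brings in a multiplier `l`; since the rim is free,
`l(1) = 0`. Stretching says that a Hamiltonian vanishes identically
(`IsRevolutionDisc.hamiltonian_eq_zero`). At the rim, where `l = 0`, this reads `u (u - k₁) = 0`.
Turning gives an equation for the momentum `a u r` and the natural condition `a u ρ + b S = 0`.

The alternative `u(1) = 0` is impossible. The pair (momentum, `l`) solves a homogeneous linear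
system, so zero data at the rim would force `u ≡ 0`. The first integral of constant mean curvature
would then give `S = -cρ ≠ 0`, while the natural condition gives `b S = 0`. Hence `u = k₁` at the
rim, and the natural condition becomes `(a + b) S = -2acρ` (`IsRevolutionDisc.boundary_angle`).

The bounds on `b` say `|a + b| ≤ 2a`, so `S² ≥ c²ρ²` and `CX² ≤ 1 - c²ρ²`. The circle therefore lies
on a sphere of radius `1/|c|`, where it bounds caps with cosines `±√(1 - c²ρ²)`. The sign for which
`b` times the cosine is larger makes the Gauss–Bonnet term no greater than that of the critical
disc. The rim terms agree, and the cap has no bending energy, while the disc has a positive amount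
because `u(1) ≠ 0`. -/

lemma rot_transpose_mul {Q : Matrix (Fin 3) (Fin 3) ℝ}
    (hQ : Q ∈ Matrix.specialOrthogonalGroup (Fin 3) ℝ) : Qᵀ * Q = 1 := by
  have h := (Matrix.mem_specialOrthogonalGroup_iff.1 hQ).1
  exact (Matrix.mem_orthogonalGroup_iff' (Fin 3) ℝ).1 h

lemma rot_mul_transpose {Q : Matrix (Fin 3) (Fin 3) ℝ}
    (hQ : Q ∈ Matrix.specialOrthogonalGroup (Fin 3) ℝ) : Q * Qᵀ = 1 :=
  mul_eq_one_comm.1 (rot_transpose_mul hQ)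

lemma rot_dot {Q : Matrix (Fin 3) (Fin 3) ℝ}
    (hQ : Q ∈ Matrix.specialOrthogonalGroup (Fin 3) ℝ) (v w : R3) :
    (Q *ᵥ v) ⬝ᵥ (Q *ᵥ w) = v ⬝ᵥ w := by
  rw [Matrix.dotProduct_mulVec, ← Matrix.mulVec_transpose, Matrix.mulVec_mulVec,
    rot_transpose_mul hQ, Matrix.one_mulVec]

/-- The polynomial identity `Qᵀ(Qv × Qw) = det Q • (v × w)` holds for every matrix; orthogonality
and determinant one finish it. -/
lemma rot_cross {Q : Matrix (Fin 3) (Fin 3) ℝ}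
    (hQ : Q ∈ Matrix.specialOrthogonalGroup (Fin 3) ℝ) (v w : R3) :
    (Q *ᵥ v) ⨯₃ (Q *ᵥ w) = Q *ᵥ (v ⨯₃ w) := by
  have hdet : Q.det = 1 := (Matrix.mem_specialOrthogonalGroup_iff.1 hQ).2
  have key : Qᵀ *ᵥ ((Q *ᵥ v) ⨯₃ (Q *ᵥ w)) = v ⨯₃ w := by
    have h0 : Qᵀ *ᵥ ((Q *ᵥ v) ⨯₃ (Q *ᵥ w)) = Q.det • (v ⨯₃ w) := by
      rw [Matrix.det_fin_three]
      ext i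
      fin_cases i <;>
        simp [cross_apply, Matrix.mulVec, dotProduct, Fin.sum_univ_three] <;> ring
    rw [h0, hdet, one_smul]
  rw [← key, Matrix.mulVec_mulVec, rot_mul_transpose hQ, Matrix.one_mulVec]

lemma rot_len {Q : Matrix (Fin 3) (Fin 3) ℝ}
    (hQ : Q ∈ Matrix.specialOrthogonalGroup (Fin 3) ℝ) (v : R3) : len (Q *ᵥ v) = len v := by
  rw [len, len, rot_dot hQ]

lemma hasDerivAt_rot (Q : Matrix (Fin 3) (Fin 3) ℝ) (q : R3) {f g h : ℝ → ℝ} {f' g' h' x : ℝ}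
    (hf : HasDerivAt f f' x) (hg : HasDerivAt g g' x) (hh : HasDerivAt h h' x) :
    HasDerivAt (fun t => q + Q *ᵥ ![f t, g t, h t]) (Q *ᵥ ![f', g', h']) x := by
  rw [hasDerivAt_pi]
  intro i
  have := (((hf.const_mul (Q i 0)).add (hg.const_mul (Q i 1))).add (hh.const_mul (Q i 2))).const_add
    (q i)
  simpa [Matrix.mulVec, dotProduct, Fin.sum_univ_three] using this

/-! ### The geometry of a surface of revolution -/

/-- `√(r'² + z'²)` -/
def speed (r z : ℝ → ℝ) (s : ℝ) : ℝ := √(deriv r s ^ 2 + deriv z s ^ 2)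

/-- The curvature of the profile curve. -/
def meridianCurv (r z : ℝ → ℝ) (s : ℝ) : ℝ :=
  (deriv (deriv z) s * deriv r s - deriv (deriv r) s * deriv z s) / speed r z s ^ 3

/-- The normal curvature of the parallels. -/
def parallelCurv (r z : ℝ → ℝ) (s : ℝ) : ℝ := deriv z s / (r s * speed r z s)

/-- The surface patch `X` is, for parameters near `s`, obtained by rotating a profile curve. -/
def RevolutionNear (X : ℝ → ℝ → R3) (Q : Matrix (Fin 3) (Fin 3) ℝ) (q : R3) (r z : ℝ → ℝ)
    (s : ℝ) : Prop :=
  ∀ᶠ x in 𝓝 s, ∀ θ, X x θ = q + Q *ᵥ ![r x * Real.cos θ, r x * Real.sin θ, z x]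

lemma eventually_differentiableAt {f : ℝ → ℝ} {s : ℝ} (hf : ContDiffAt ℝ 2 f s) :
    ∀ᶠ x in 𝓝 s, DifferentiableAt ℝ f x :=
  (hf.eventually (by simp)).mono fun _ hx => hx.differentiableAt (by norm_num)

lemma differentiableAt_deriv {f : ℝ → ℝ} {s : ℝ} (hf : ContDiffAt ℝ 2 f s) :
    DifferentiableAt ℝ (deriv f) s := by
  have : ContDiffAt ℝ 1 (deriv f) s := by
    have h := hf.fderiv_right (m := 1) (by norm_num)
    have h2 := h.clm_apply (contDiffAt_const (c := (1 : ℝ)))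
    exact h2.congr_of_eventuallyEq (Eventually.of_forall fun x => by simp)
  exact this.differentiableAt (by norm_num)

section

variable {X : ℝ → ℝ → R3} {Q : Matrix (Fin 3) (Fin 3) ℝ} {q : R3} {r z : ℝ → ℝ} {s : ℝ}

lemma RevolutionNear.d2_eq (hX : RevolutionNear X Q q r z s) :
    ∀ᶠ x in 𝓝 s, ∀ θ, d2 X x θ = Q *ᵥ ![-(r x * Real.sin θ), r x * Real.cos θ, 0] := by
  filter_upwards [hX] with x hx θ
  have : (fun y => X x y) = fun y => q + Q *ᵥ ![r x * Real.cos y, r x * Real.sin y, z x] :=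
    funext hx
  rw [d2, this]
  refine (hasDerivAt_rot Q q ?_ ((Real.hasDerivAt_sin θ).const_mul _) (hasDerivAt_const _ _)).deriv
  simpa using (Real.hasDerivAt_cos θ).const_mul (r x)

lemma RevolutionNear.d1_eq (hX : RevolutionNear X Q q r z s)
    (hr : ∀ᶠ x in 𝓝 s, DifferentiableAt ℝ r x) (hz : ∀ᶠ x in 𝓝 s, DifferentiableAt ℝ z x) :
    ∀ᶠ x in 𝓝 s, ∀ θ,
      d1 X x θ = Q *ᵥ ![deriv r x * Real.cos θ, deriv r x * Real.sin θ, deriv z x] := by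
  filter_upwards [hX.eventually_nhds, hr, hz] with x hx hrx hzx θ
  have : (fun y => X y θ) =ᶠ[𝓝 x]
      fun y => q + Q *ᵥ ![r y * Real.cos θ, r y * Real.sin θ, z y] := hx.mono fun y hy => hy θ
  rw [d1, this.deriv_eq]
  exact (hasDerivAt_rot Q q (hrx.hasDerivAt.mul_const _) (hrx.hasDerivAt.mul_const _)
    hzx.hasDerivAt).deriv

/-- Differentiation in `s` yields again a rotated profile, so the first-order formulas can be reused
for the second derivatives. -/
lemma RevolutionNear.d1_near (hX : RevolutionNear X Q q r z s) (hr : ContDiffAt ℝ 2 r s)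
    (hz : ContDiffAt ℝ 2 z s) : RevolutionNear (d1 X) Q 0 (deriv r) (deriv z) s := by
  filter_upwards [hX.d1_eq (eventually_differentiableAt hr) (eventually_differentiableAt hz)]
    with x hx θ
  rw [hx θ, zero_add]

lemma RevolutionNear.d11_eq (hX : RevolutionNear X Q q r z s) (hr : ContDiffAt ℝ 2 r s)
    (hz : ContDiffAt ℝ 2 z s) (θ : ℝ) :
    d11 X s θ = Q *ᵥ ![deriv (deriv r) s * Real.cos θ, deriv (deriv r) s * Real.sin θ,
      deriv (deriv z) s] := by
  have h := hX.d1_near hr hz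
  have h1 : (fun y => d1 X y θ) =ᶠ[𝓝 s] fun y =>
      0 + Q *ᵥ ![deriv r y * Real.cos θ, deriv r y * Real.sin θ, deriv z y] :=
    h.mono fun y hy => hy θ
  rw [d11, d1, h1.deriv_eq]
  have hr' := (differentiableAt_deriv hr).hasDerivAt
  exact (hasDerivAt_rot Q 0 (hr'.mul_const _) (hr'.mul_const _)
    (differentiableAt_deriv hz).hasDerivAt).deriv

lemma RevolutionNear.d12_eq (hX : RevolutionNear X Q q r z s) (hr : ContDiffAt ℝ 2 r s)
    (hz : ContDiffAt ℝ 2 z s) (θ : ℝ) :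
    d12 X s θ = Q *ᵥ ![-(deriv r s * Real.sin θ), deriv r s * Real.cos θ, 0] :=
  (hX.d1_near hr hz).d2_eq.self_of_nhds θ

lemma RevolutionNear.d22_eq (hX : RevolutionNear X Q q r z s) (θ : ℝ) :
    d22 X s θ = Q *ᵥ ![-(r s * Real.cos θ), -(r s * Real.sin θ), 0] := by
  have h1 : (fun y => d2 X s y) = fun y =>
      0 + Q *ᵥ ![-(r s * Real.sin y), r s * Real.cos y, 0] := by
    funext y
    rw [hX.d2_eq.self_of_nhds y, zero_add]
  rw [d22, d2, h1]
  refine (hasDerivAt_rot Q 0 ?_ ?_ (hasDerivAt_const _ _)).deriv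
  · exact ((Real.hasDerivAt_sin θ).const_mul _).neg
  · simpa using (Real.hasDerivAt_cos θ).const_mul (r s)

lemma RevolutionNear.cross_eq (hQ : Q ∈ Matrix.specialOrthogonalGroup (Fin 3) ℝ)
    (hX : RevolutionNear X Q q r z s) (hr : ContDiffAt ℝ 2 r s)
    (hz : ContDiffAt ℝ 2 z s) (θ : ℝ) :
    d1 X s θ ⨯₃ d2 X s θ = Q *ᵥ ![-(deriv z s * r s * Real.cos θ),
      -(deriv z s * r s * Real.sin θ), deriv r s * r s] := by
  rw [(hX.d1_eq (eventually_differentiableAt hr) (eventually_differentiableAt hz)).self_of_nhds θ,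
    hX.d2_eq.self_of_nhds θ, rot_cross hQ]
  congr 1
  ext i
  fin_cases i <;> simp [cross_apply]
  · ring
  · ring
  · linear_combination (deriv r s * r s) * Real.sin_sq_add_cos_sq θ

lemma RevolutionNear.areaDensity_eq (hQ : Q ∈ Matrix.specialOrthogonalGroup (Fin 3) ℝ)
    (hX : RevolutionNear X Q q r z s) (hr : ContDiffAt ℝ 2 r s)
    (hz : ContDiffAt ℝ 2 z s) (h0 : 0 ≤ r s) (θ : ℝ) :
    areaDensity X s θ = r s * speed r z s := by
  rw [areaDensity, hX.cross_eq hQ hr hz, rot_len hQ, len, speed]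
  conv_rhs => rw [← Real.sqrt_sq h0, ← Real.sqrt_mul (sq_nonneg _)]
  congr 1
  simp [dotProduct, Fin.sum_univ_three]
  linear_combination (deriv z s * r s) ^ 2 * Real.sin_sq_add_cos_sq θ

lemma RevolutionNear.unitNormal_eq (hQ : Q ∈ Matrix.specialOrthogonalGroup (Fin 3) ℝ)
    (hX : RevolutionNear X Q q r z s) (hr : ContDiffAt ℝ 2 r s)
    (hz : ContDiffAt ℝ 2 z s) (h0 : 0 < r s) (θ : ℝ) :
    unitNormal X s θ = Q *ᵥ ![-(deriv z s / speed r z s * Real.cos θ),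
      -(deriv z s / speed r z s * Real.sin θ), deriv r s / speed r z s] := by
  rw [unitNormal, hX.areaDensity_eq hQ hr hz h0.le, hX.cross_eq hQ hr hz, ← Matrix.mulVec_smul]
  congr 1
  ext i
  fin_cases i <;> simp <;> field_simp

lemma speed_sq (r z : ℝ → ℝ) (s : ℝ) : speed r z s ^ 2 = deriv r s ^ 2 + deriv z s ^ 2 :=
  Real.sq_sqrt (by positivity)

lemma RevolutionNear.firstDet_eq (hQ : Q ∈ Matrix.specialOrthogonalGroup (Fin 3) ℝ)
    (hX : RevolutionNear X Q q r z s) (hr : ContDiffAt ℝ 2 r s)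
    (hz : ContDiffAt ℝ 2 z s) (θ : ℝ) :
    d1 X s θ ⬝ᵥ d1 X s θ = speed r z s ^ 2 ∧ d1 X s θ ⬝ᵥ d2 X s θ = 0 ∧
      d2 X s θ ⬝ᵥ d2 X s θ = r s ^ 2 := by
  rw [(hX.d1_eq (eventually_differentiableAt hr) (eventually_differentiableAt hz)).self_of_nhds θ,
    hX.d2_eq.self_of_nhds θ, rot_dot hQ, rot_dot hQ, rot_dot hQ, speed_sq]
  simp [dotProduct, Fin.sum_univ_three]
  refine ⟨?_, ?_, ?_⟩
  · linear_combination deriv r s ^ 2 * Real.sin_sq_add_cos_sq θ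
  · ring
  · linear_combination r s ^ 2 * Real.sin_sq_add_cos_sq θ

/-- Meridians and parallels are lines of curvature: the mixed coefficient vanishes, and the other
two are principal curvatures times the metric coefficients. -/
lemma RevolutionNear.secondForm_eq (hQ : Q ∈ Matrix.specialOrthogonalGroup (Fin 3) ℝ)
    (hX : RevolutionNear X Q q r z s) (hr : ContDiffAt ℝ 2 r s)
    (hz : ContDiffAt ℝ 2 z s) (h0 : 0 < r s) (hw : 0 < speed r z s) (θ : ℝ) :
    d11 X s θ ⬝ᵥ unitNormal X s θ = meridianCurv r z s * speed r z s ^ 2 ∧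
      d12 X s θ ⬝ᵥ unitNormal X s θ = 0 ∧
      d22 X s θ ⬝ᵥ unitNormal X s θ = parallelCurv r z s * r s ^ 2 := by
  rw [hX.unitNormal_eq hQ hr hz h0, hX.d11_eq hr hz, hX.d12_eq hr hz, hX.d22_eq, rot_dot hQ,
    rot_dot hQ, rot_dot hQ, meridianCurv, parallelCurv]
  simp [dotProduct, Fin.sum_univ_three]
  refine ⟨?_, ?_, ?_⟩
  · field_simp
    linear_combination (-deriv z s * deriv (deriv r) s) * Real.sin_sq_add_cos_sq θ
  · ring
  · field_simp
    linear_combination (deriv z s) * Real.sin_sq_add_cos_sq θ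

lemma RevolutionNear.meanCurvature_eq (hQ : Q ∈ Matrix.specialOrthogonalGroup (Fin 3) ℝ)
    (hX : RevolutionNear X Q q r z s) (hr : ContDiffAt ℝ 2 r s)
    (hz : ContDiffAt ℝ 2 z s) (h0 : 0 < r s) (hw : 0 < speed r z s) (θ : ℝ) :
    meanCurvature X s θ = (meridianCurv r z s + parallelCurv r z s) / 2 := by
  obtain ⟨e1, e2, e3⟩ := hX.firstDet_eq hQ hr hz θ
  obtain ⟨l1, l2, l3⟩ := hX.secondForm_eq hQ hr hz h0 hw θ
  rw [meanCurvature, firstDet, e1, e2, e3, l1, l2, l3]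
  field_simp
  ring

lemma RevolutionNear.gaussCurvature_eq (hQ : Q ∈ Matrix.specialOrthogonalGroup (Fin 3) ℝ)
    (hX : RevolutionNear X Q q r z s) (hr : ContDiffAt ℝ 2 r s)
    (hz : ContDiffAt ℝ 2 z s) (h0 : 0 < r s) (hw : 0 < speed r z s) (θ : ℝ) :
    gaussCurvature X s θ = meridianCurv r z s * parallelCurv r z s := by
  obtain ⟨e1, e2, e3⟩ := hX.firstDet_eq hQ hr hz θ
  obtain ⟨l1, l2, l3⟩ := hX.secondForm_eq hQ hr hz h0 hw θ
  rw [gaussCurvature, firstDet, e1, e2, e3, l1, l2, l3]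
  field_simp
  ring

end

/-- The energy density of a circle of radius `ρ` about the axis. -/
lemma boundary_integrand_eq {C : ℝ → R3} {Q : Matrix (Fin 3) (Fin 3) ℝ} {q : R3} {ρ h : ℝ}
    (hQ : Q ∈ Matrix.specialOrthogonalGroup (Fin 3) ℝ) (hρ : 0 < ρ)
    (hC : ∀ θ, C θ = q + Q *ᵥ ![ρ * Real.cos θ, ρ * Real.sin θ, h]) (θ : ℝ) :
    curveCurvature C θ = 1 / ρ ∧ len (deriv C θ) = ρ := by
  have h1 : deriv C = fun θ => 0 + Q *ᵥ ![-(ρ * Real.sin θ), ρ * Real.cos θ, 0] := by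
    funext θ
    rw [funext hC, zero_add]
    refine (hasDerivAt_rot Q q ?_ ((Real.hasDerivAt_sin θ).const_mul _)
      (hasDerivAt_const _ _)).deriv
    simpa using (Real.hasDerivAt_cos θ).const_mul ρ
  have h2 : deriv (deriv C) θ = Q *ᵥ ![-(ρ * Real.cos θ), -(ρ * Real.sin θ), 0] := by
    rw [h1]
    refine (hasDerivAt_rot Q 0 ?_ ?_ (hasDerivAt_const _ _)).deriv
    · exact ((Real.hasDerivAt_sin θ).const_mul _).neg
    · simpa using (Real.hasDerivAt_cos θ).const_mul ρ
  have h3 : len (deriv C θ) = ρ := by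
    rw [h1]
    beta_reduce
    rw [zero_add, rot_len hQ, len]
    conv_rhs => rw [← Real.sqrt_sq hρ.le]
    congr 1
    simp [dotProduct, Fin.sum_univ_three]
    linear_combination ρ ^ 2 * Real.sin_sq_add_cos_sq θ
  refine ⟨?_, h3⟩
  have h4 : len (deriv C θ ⨯₃ deriv (deriv C) θ) = ρ ^ 2 := by
    rw [h2, h1]
    beta_reduce
    rw [zero_add, rot_cross hQ, rot_len hQ, len]
    conv_rhs => rw [← Real.sqrt_sq (by positivity : 0 ≤ ρ ^ 2)]
    congr 1
    have : ρ * Real.sin θ * (ρ * Real.sin θ) + ρ * Real.cos θ * (ρ * Real.cos θ) = ρ ^ 2 := by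
      linear_combination ρ ^ 2 * Real.sin_sq_add_cos_sq θ
    simp [cross_apply, dotProduct, Fin.sum_univ_three, this]
    ring
  rw [curveCurvature, h3, h4]
  field_simp

/-! ### The energy of a disc of revolution -/

/-- A profile curve of class `C⁴` that generates an immersed disc. -/
structure RegularProfile (r z : ℝ → ℝ) : Prop where
  contDiff_r : ContDiff ℝ 4 r
  contDiff_z : ContDiff ℝ 4 z
  r_zero : r 0 = 0
  deriv_r_zero : 0 < deriv r 0
  deriv_z_zero : deriv z 0 = 0
  r_pos : ∀ s ∈ Ioc (0 : ℝ) 1, 0 < r s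
  speed_pos : ∀ s ∈ Icc (0 : ℝ) 1, 0 < speed r z s

/-- `H + c` -/
def shiftedMean (c : ℝ) (r z : ℝ → ℝ) (s : ℝ) : ℝ :=
  (meridianCurv r z s + parallelCurv r z s) / 2 + c

/-- The density of the bending energy along the profile curve. -/
def bendingDensity (a c : ℝ) (r z : ℝ → ℝ) (s : ℝ) : ℝ :=
  a * shiftedMean c r z s ^ 2 * (r s * speed r z s)

lemma contDiff_deriv {f : ℝ → ℝ} (n : ℕ) (hf : ContDiff ℝ (n + 1 : ℕ) f) :
    ContDiff ℝ n (deriv f) := by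
  have h : ContDiff ℝ ((n : WithTop ℕ∞) + 1) f := by exact_mod_cast hf
  exact (contDiff_succ_iff_deriv.1 h).2.2

lemma hasDerivAt_speed {r z : ℝ → ℝ} {s r2 z2 : ℝ} (hr : HasDerivAt (deriv r) r2 s)
    (hz : HasDerivAt (deriv z) z2 s) (hw : 0 < speed r z s) :
    HasDerivAt (speed r z) ((deriv r s * r2 + deriv z s * z2) / speed r z s) s := by
  have h0 : deriv r s ^ 2 + deriv z s ^ 2 ≠ 0 := by
    rw [← speed_sq]
    positivity
  have h := ((hr.pow 2).add (hz.pow 2)).sqrt h0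
  refine h.congr_deriv ?_
  simp only [Pi.add_apply, Pi.pow_apply]
  change _ / (2 * speed r z s) = _
  field_simp
  ring

namespace RegularProfile

variable {r z : ℝ → ℝ}

lemma contDiff_deriv_r (h : RegularProfile r z) : ContDiff ℝ 3 (deriv r) :=
  contDiff_deriv 3 h.contDiff_r

lemma contDiff_deriv_z (h : RegularProfile r z) : ContDiff ℝ 3 (deriv z) :=
  contDiff_deriv 3 h.contDiff_z

lemma contDiff_deriv2_r (h : RegularProfile r z) : ContDiff ℝ 2 (deriv (deriv r)) :=
  contDiff_deriv 2 h.contDiff_deriv_r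

lemma contDiff_deriv2_z (h : RegularProfile r z) : ContDiff ℝ 2 (deriv (deriv z)) :=
  contDiff_deriv 2 h.contDiff_deriv_z

lemma hasDerivAt_r (h : RegularProfile r z) (s : ℝ) : HasDerivAt r (deriv r s) s :=
  (h.contDiff_r.differentiable (by norm_num) s).hasDerivAt

lemma hasDerivAt_deriv_r (h : RegularProfile r z) (s : ℝ) :
    HasDerivAt (deriv r) (deriv (deriv r) s) s :=
  (h.contDiff_deriv_r.differentiable (by norm_num) s).hasDerivAt

lemma hasDerivAt_deriv_z (h : RegularProfile r z) (s : ℝ) :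
    HasDerivAt (deriv z) (deriv (deriv z) s) s :=
  (h.contDiff_deriv_z.differentiable (by norm_num) s).hasDerivAt

lemma continuous_speed (h : RegularProfile r z) : Continuous (speed r z) := by
  have h1 := h.contDiff_deriv_r.continuous
  have h2 := h.contDiff_deriv_z.continuous
  unfold speed
  fun_prop

lemma continuousOn_meridianCurv (h : RegularProfile r z) :
    ContinuousOn (meridianCurv r z) (Icc 0 1) := by
  have h1 := h.contDiff_deriv_r.continuous
  have h2 := h.contDiff_deriv_z.continuous
  have h3 := h.contDiff_deriv2_r.continuous
  have h4 := h.contDiff_deriv2_z.continuous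
  have h5 := h.continuous_speed
  unfold meridianCurv
  refine ContinuousOn.div (by fun_prop) (by fun_prop) fun s hs => ?_
  exact pow_ne_zero _ (h.speed_pos s hs).ne'

lemma continuousOn_parallelCurv (h : RegularProfile r z) :
    ContinuousOn (parallelCurv r z) (Ioc 0 1) := by
  have h1 := h.contDiff_r.continuous
  have h2 := h.contDiff_deriv_z.continuous
  have h5 := h.continuous_speed
  unfold parallelCurv
  refine ContinuousOn.div (by fun_prop) (by fun_prop) fun s hs => ?_
  exact (mul_pos (h.r_pos s hs) (h.speed_pos s (Ioc_subset_Icc_self hs))).ne'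

lemma continuousOn_shiftedMean (h : RegularProfile r z) (c : ℝ) :
    ContinuousOn (shiftedMean c r z) (Ioc 0 1) := by
  have h1 := h.continuousOn_meridianCurv.mono Ioc_subset_Icc_self
  have h2 := h.continuousOn_parallelCurv
  unfold shiftedMean
  fun_prop

lemma continuousOn_bendingDensity (h : RegularProfile r z) (a c : ℝ) :
    ContinuousOn (bendingDensity a c r z) (Ioc 0 1) := by
  have h1 := h.continuousOn_shiftedMean c
  have h2 := h.contDiff_r.continuous
  have h3 := h.continuous_speed
  unfold bendingDensity
  fun_prop

/-- The only issue is the quotient `z'/r` at the axis. Both functions vanish at `0` and `r'(0) > 0`,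
so dividing each by `s` (via `dslope`) exhibits a continuous extension to `[0, 1]`. -/
lemma intervalIntegrable_bendingDensity (h : RegularProfile r z) (a c : ℝ) :
    IntervalIntegrable (bendingDensity a c r z) MeasureTheory.volume 0 1 := by
  have hrd : Continuous (dslope r 0) := by
    rw [← continuousOn_univ, continuousOn_dslope univ_mem]
    exact ⟨h.contDiff_r.continuous.continuousOn, (h.hasDerivAt_r 0).differentiableAt⟩
  have hzd : Continuous (dslope (deriv z) 0) := by
    rw [← continuousOn_univ, continuousOn_dslope univ_mem]
    exact ⟨h.contDiff_deriv_z.continuous.continuousOn, (h.hasDerivAt_deriv_z 0).differentiableAt⟩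
  have hr_eq : ∀ s, r s = s * dslope r 0 s := fun s => by
    have := sub_smul_dslope r 0 s
    simpa [h.r_zero] using this.symm
  have hz_eq : ∀ s, deriv z s = s * dslope (deriv z) 0 s := fun s => by
    have := sub_smul_dslope (deriv z) 0 s
    simpa [h.deriv_z_zero] using this.symm
  have hpos : ∀ s ∈ Icc (0 : ℝ) 1, 0 < dslope r 0 s := fun s hs => by
    rcases hs.1.eq_or_lt with h0 | h0
    · rw [← h0, dslope_same]
      exact h.deriv_r_zero
    · have := h.r_pos s ⟨h0, hs.2⟩
      rw [hr_eq s] at this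
      exact pos_of_mul_pos_right this h0.le
  have h1 := h.continuousOn_meridianCurv
  have h2 := h.contDiff_r.continuous
  have h3 := h.continuous_speed
  have hq : ContinuousOn (fun s => dslope (deriv z) 0 s / (dslope r 0 s * speed r z s))
      (Icc 0 1) := by
    refine ContinuousOn.div (by fun_prop) (by fun_prop) fun s hs => ?_
    exact (mul_pos (hpos s hs) (h.speed_pos s hs)).ne'
  have hc : ContinuousOn (fun s => a * ((meridianCurv r z s +
      dslope (deriv z) 0 s / (dslope r 0 s * speed r z s)) / 2 + c) ^ 2 * (r s * speed r z s))
      (Icc 0 1) := by fun_prop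
  refine (hc.intervalIntegrable_of_Icc zero_le_one).congr_uIoo fun s hs => ?_
  rw [uIoo_of_le zero_le_one] at hs
  have hp : parallelCurv r z s = dslope (deriv z) 0 s / (dslope r 0 s * speed r z s) := by
    have hs0 : s ≠ 0 := hs.1.ne'
    rw [parallelCurv, hr_eq s, hz_eq s, mul_assoc, mul_div_mul_left _ _ hs0]
  simp only [bendingDensity, shiftedMean, hp]

/-- If `φ` is the tangent angle, then `φ' = k₁ w` and `sin φ = z'/w`, so `(cos φ)' = -k₁ z'`. -/
lemma hasDerivAt_cos_angle (h : RegularProfile r z) {s : ℝ} (hs : s ∈ Icc (0 : ℝ) 1) :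
    HasDerivAt (fun x => deriv r x / speed r z x) (-(meridianCurv r z s * deriv z s)) s := by
  have hw := h.speed_pos s hs
  have h1 := (h.hasDerivAt_deriv_r s).div
    (hasDerivAt_speed (h.hasDerivAt_deriv_r s) (h.hasDerivAt_deriv_z s) hw) hw.ne'
  refine h1.congr_deriv ?_
  rw [meridianCurv]
  field_simp
  rw [speed_sq]
  ring

/-- Since `k₂ r w = z'`, the integrand is `K` times the area density, minus the derivative of the
cosine of the tangent angle. That cosine is `1` on the axis. -/
lemma integral_gaussCurvature (h : RegularProfile r z) :
    ∫ s in (0 : ℝ)..1, meridianCurv r z s * deriv z s = 1 - deriv r 1 / speed r z 1 := by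
  have h0 : deriv r 0 / speed r z 0 = 1 := by
    rw [speed, h.deriv_z_zero]
    simp [Real.sqrt_sq h.deriv_r_zero.le, h.deriv_r_zero.ne']
  have hc : ContinuousOn (fun s => -(meridianCurv r z s * deriv z s)) (Icc 0 1) := by
    have h1 := h.continuousOn_meridianCurv
    have h2 := h.contDiff_deriv_z.continuous
    fun_prop
  have key := intervalIntegral.integral_eq_sub_of_hasDerivAt (a := 0) (b := 1)
    (fun s hs => h.hasDerivAt_cos_angle (by rwa [uIcc_of_le zero_le_one] at hs))
    (hc.intervalIntegrable_of_Icc zero_le_one)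
  rw [intervalIntegral.integral_neg, h0] at key
  linarith

end RegularProfile

lemma IsRevolutionDisc.revolutionNear {F : ℝ × ℝ → R3} {Q : Matrix (Fin 3) (Fin 3) ℝ} {q : R3}
    {r z : ℝ → ℝ} (h : IsRevolutionDisc F Q q r z) {s : ℝ} (hs : s ∈ Ioo (0 : ℝ) 1) :
    RevolutionNear (polar F) Q q r z s := by
  filter_upwards [Ioo_mem_nhds hs.1 hs.2] with x hx θ
  exact h.eq_rotate x (Ioo_subset_Icc_self hx) θ

/-- The energy of a disc of revolution; the Gaussian curvature is integrated by the theorem of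
Gauss and Bonnet. -/
lemma IsRevolutionDisc.energy_eq {F : ℝ × ℝ → R3} {Q : Matrix (Fin 3) (Fin 3) ℝ} {q : R3}
    {r z : ℝ → ℝ} (hF : IsRevolutionDisc F Q q r z) (h : RegularProfile r z) (a c b α β : ℝ) :
    energy a c b α β F = 2 * Real.pi * (∫ s in (0 : ℝ)..1, bendingDensity a c r z s)
      + 2 * Real.pi * b * (1 - deriv r 1 / speed r z 1)
      + 2 * Real.pi * ((α * (1 / r 1) ^ 2 + β) * r 1) := by
  have hK : IntervalIntegrable (fun s => meridianCurv r z s * deriv z s)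
      MeasureTheory.volume 0 1 := by
    have h1 := h.continuousOn_meridianCurv
    have h2 := h.contDiff_deriv_z.continuous
    exact ContinuousOn.intervalIntegrable_of_Icc zero_le_one (by fun_prop)
  have hin : ∀ θ : ℝ, (∫ s in (0 : ℝ)..1,
      (a * (meanCurvature (polar F) s θ + c) ^ 2 + b * gaussCurvature (polar F) s θ)
        * areaDensity (polar F) s θ) =
      (∫ s in (0 : ℝ)..1, bendingDensity a c r z s)
        + b * (1 - deriv r 1 / speed r z 1) := by
    intro θ
    rw [← h.integral_gaussCurvature, ← intervalIntegral.integral_const_mul,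
      ← intervalIntegral.integral_add (h.intervalIntegrable_bendingDensity a c)
        (hK.const_mul b)]
    refine intervalIntegral.integral_congr_Ioo_of_le zero_le_one fun s hs => ?_
    have hX := hF.revolutionNear hs
    have hr0 := h.r_pos s (Ioo_subset_Ioc_self hs)
    have hw := h.speed_pos s (Ioo_subset_Icc_self hs)
    have hr2 : ContDiffAt ℝ 2 r s := (h.contDiff_r.of_le (by norm_num)).contDiffAt
    have hz2 : ContDiffAt ℝ 2 z s := (h.contDiff_z.of_le (by norm_num)).contDiffAt
    rw [hX.meanCurvature_eq hF.rotation hr2 hz2 hr0 hw,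
      hX.gaussCurvature_eq hF.rotation hr2 hz2 hr0 hw,
      hX.areaDensity_eq hF.rotation hr2 hz2 hr0.le, bendingDensity, shiftedMean]
    have : parallelCurv r z s * (r s * speed r z s) = deriv z s := by
      rw [parallelCurv]
      field_simp
    linear_combination b * meridianCurv r z s * this
  have hbd := boundary_integrand_eq (C := boundaryCurve F) hF.rotation
    (h.r_pos 1 ⟨zero_lt_one, le_rfl⟩) (fun θ => hF.eq_rotate 1 ⟨zero_le_one, le_rfl⟩ θ)
  rw [energy]
  simp only [hin, (hbd _).1, (hbd _).2, intervalIntegral.integral_const, smul_eq_mul]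
  ring

/-! ### The profile curve of an axially symmetric disc -/

/-- The vector `F(s, 0)` in the frame of the axis. -/
def ray (F : ℝ × ℝ → R3) (Q : Matrix (Fin 3) (Fin 3) ℝ) (q : R3) (s : ℝ) : R3 :=
  Qᵀ *ᵥ (F (s, 0) - q)

lemma contDiff_ray {F : ℝ × ℝ → R3} (hF : ContDiff ℝ 4 F) (Q : Matrix (Fin 3) (Fin 3) ℝ)
    (q : R3) (i : Fin 3) : ContDiff ℝ 4 (fun s => ray F Q q s i) := by
  have h : ContDiff ℝ 4 (fun s : ℝ => F (s, 0)) := hF.comp (by fun_prop)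
  have h' := contDiff_pi.1 h
  simp only [ray, Matrix.mulVec, dotProduct, Pi.sub_apply]
  exact ContDiff.sum fun j _ => contDiff_const.mul ((h' j).sub contDiff_const)

lemma hasDerivAt_zero_of_Icc {f : ℝ → ℝ} {f' s k : ℝ} (hs : s ∈ Icc (0 : ℝ) 1)
    (hf : HasDerivAt f f' s) (h0 : ∀ x ∈ Icc (0 : ℝ) 1, f x = k) : f' = 0 := by
  have h1 := hf.hasDerivWithinAt (s := Icc 0 1)
  have h2 : HasDerivWithinAt f 0 (Icc 0 1) s :=
    (hasDerivWithinAt_const s _ k).congr h0 (h0 s hs)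
  exact (uniqueDiffOn_Icc zero_lt_one s hs).eq_deriv _ h1 h2

/-- The profile curve of an axially symmetric immersed disc can be taken of class `C⁴` on the
whole line and regular. -/
lemma IsRevolutionDisc.exists_regularProfile {F : ℝ × ℝ → R3} {Q : Matrix (Fin 3) (Fin 3) ℝ}
    {q : R3} {r z : ℝ → ℝ} (h : IsRevolutionDisc F Q q r z) (hF : IsImmersedDisc F) :
    ∃ r' z' : ℝ → ℝ, RegularProfile r' z' ∧ IsRevolutionDisc F Q q r' z' ∧ r' 1 = r 1 := by
  have hQ := h.rotation
  -- The given `r` and `z` carry no regularity. They are replaced by coordinates of the straight ray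
  -- through the centre, which is `C⁴` on the whole line; its negative half is the ray `θ = π`.
  have hray : ∀ s ∈ Icc (0 : ℝ) 1, ray F Q q s = ![r s, 0, z s] ∧
      ray F Q q (-s) = ![-r s, 0, z s] := by
    intro s hs
    have e0 := h.eq_rotate s hs 0
    have e1 := h.eq_rotate s hs Real.pi
    simp only [polar, Real.cos_zero, Real.sin_zero, Real.cos_pi, Real.sin_pi, mul_one, mul_zero,
      mul_neg] at e0 e1
    constructor
    · rw [ray, e0, add_sub_cancel_left, Matrix.mulVec_mulVec, rot_transpose_mul hQ,
        Matrix.one_mulVec]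
    · rw [ray, e1, add_sub_cancel_left, Matrix.mulVec_mulVec, rot_transpose_mul hQ,
        Matrix.one_mulVec]
  have hcd := contDiff_ray hF.contDiff Q q
  have hdiff : ∀ i s, HasDerivAt (fun s => ray F Q q s i)
      (deriv (fun s => ray F Q q s i) s) s := fun i s =>
    ((hcd i).differentiable (by norm_num) s).hasDerivAt
  have hFd : Differentiable ℝ F := hF.contDiff.differentiable (by norm_num)
  have hFcurve : ∀ s, HasDerivAt (fun s : ℝ => F (s, 0)) (fderiv ℝ F (s, 0) (1, 0)) s := by
    intro s
    have h1 : HasDerivAt (fun s : ℝ => (s, (0 : ℝ))) (1, 0) s :=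
      (hasDerivAt_id s).prodMk (hasDerivAt_const s 0)
    exact (hFd (s, 0)).hasFDerivAt.comp_hasDerivAt s h1
  have hderiv : ∀ s i, deriv (fun s => ray F Q q s i) s =
      (Qᵀ *ᵥ fderiv ℝ F (s, 0) (1, 0)) i := by
    intro s i
    have h1 := hasDerivAt_pi.1 (hFcurve s)
    have h2 : HasDerivAt (fun s => ray F Q q s i) ((Qᵀ *ᵥ fderiv ℝ F (s, 0) (1, 0)) i) s := by
      simp only [ray, Matrix.mulVec, dotProduct, Pi.sub_apply]
      exact HasDerivAt.fun_sum fun j _ => ((h1 j).sub_const _).const_mul _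
    exact h2.deriv
  have hdisc : ∀ s ∈ Icc (0 : ℝ) 1, ((s, 0) : ℝ × ℝ) ∈ disc := by
    intro s hs
    simp only [disc, mem_ofPred_eq]
    nlinarith [hs.1, hs.2]
  have hspeed : ∀ s ∈ Icc (0 : ℝ) 1,
      0 < speed (fun s => ray F Q q s 0) (fun s => ray F Q q s 2) s := by
    intro s hs
    refine Real.sqrt_pos.2 ?_
    by_contra hle
    have hy : deriv (fun s => ray F Q q s 1) s = 0 :=
      hasDerivAt_zero_of_Icc hs (hdiff 1 s) (k := 0) fun x hx => by rw [(hray x hx).1]; rfl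
    have hx : deriv (fun s => ray F Q q s 0) s = 0 := by
      by_contra hne
      exact hle (by positivity)
    have hz : deriv (fun s => ray F Q q s 2) s = 0 := by
      by_contra hne
      exact hle (by positivity)
    rw [hderiv] at hx hy hz
    have hv : Qᵀ *ᵥ fderiv ℝ F (s, 0) (1, 0) = 0 := by
      ext i
      fin_cases i
      · exact hx
      · exact hy
      · exact hz
    have hv2 : fderiv ℝ F (s, 0) (1, 0) = 0 := by
      have := congrArg (fun v => Q *ᵥ v) hv
      simpa [Matrix.mulVec_mulVec, rot_mul_transpose hQ] using this
    have := hF.immersion (s, 0) (hdisc s hs) (hv2.trans (map_zero _).symm)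
    simp at this
  have hzero : (0 : ℝ) ∈ Icc (0 : ℝ) 1 := ⟨le_rfl, zero_le_one⟩
  have hr0 : r 0 = 0 := by
    have h1 := congrFun (hray 0 hzero).1 0
    have h2 := congrFun (hray 0 hzero).2 0
    simp only [neg_zero] at h2
    rw [h1] at h2
    simp at h2
    linarith
  -- The height along the ray is even, so its derivative at the centre vanishes.
  have hz0 : deriv (fun s => ray F Q q s 2) 0 = 0 := by
    have h1 : HasDerivAt (fun s => ray F Q q s 2) (deriv (fun s => ray F Q q s 2) 0) (-0) := by
      simpa using hdiff 2 0
    have h2 := (h1.comp 0 (hasDerivAt_neg 0)).sub (hdiff 2 0)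
    have h3 := hasDerivAt_zero_of_Icc hzero h2 (k := 0) fun x hx => by
      simp [(hray x hx).1, (hray x hx).2]
    linarith
  have hr_nonneg : 0 ≤ deriv (fun s => ray F Q q s 0) 0 := by
    have h1 : HasDerivWithinAt (fun s => ray F Q q s 0) (deriv (fun s => ray F Q q s 0) 0)
      (Ioi 0) 0 := (hdiff 0 0).hasDerivWithinAt
    rw [hasDerivWithinAt_iff_tendsto_slope' (by simp)] at h1
    refine ge_of_tendsto h1 ?_
    filter_upwards [Ioo_mem_nhdsGT (zero_lt_one (α := ℝ))] with x hx
    rw [slope_def_field, (hray x (Ioo_subset_Icc_self hx)).1, (hray 0 hzero).1]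
    have := h.nonneg x (Ioo_subset_Icc_self hx)
    simp only [Matrix.cons_val_zero, hr0, sub_zero]
    exact div_nonneg this hx.1.le
  refine ⟨fun s => ray F Q q s 0, fun s => ray F Q q s 2,
    ⟨hcd 0, hcd 2, ?_, ?_, hz0, ?_, hspeed⟩, ⟨hQ, ?_, ?_⟩, ?_⟩
  · simp [(hray 0 hzero).1, hr0]
  · refine lt_of_le_of_ne hr_nonneg fun heq => ?_
    have := hspeed 0 hzero
    rw [speed, ← heq, hz0] at this
    simp at this
  · intro s hs
    have hs' := Ioc_subset_Icc_self hs
    simp only [(hray s hs').1, Matrix.cons_val_zero]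
    -- If `r s = 0` with `s > 0`, a whole parameter circle collapses to a point and the angular
    -- derivative vanishes, against the immersion property.
    refine lt_of_le_of_ne (h.nonneg s hs') fun heq => ?_
    have h1 : HasDerivAt (fun θ : ℝ => (s * Real.cos θ, s * Real.sin θ)) (0, s) 0 := by
      have e1 := (Real.hasDerivAt_cos 0).const_mul s
      have e2 := (Real.hasDerivAt_sin 0).const_mul s
      simpa using e1.prodMk e2
    have h2 : HasDerivAt (polar F s) (fderiv ℝ F (s, 0) (0, s)) 0 := by
      have h3 : HasFDerivAt F (fderiv ℝ F (s, 0)) (s * Real.cos 0, s * Real.sin 0) := by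
        simpa using (hFd (s, 0)).hasFDerivAt
      exact h3.comp_hasDerivAt 0 h1
    have h4 : polar F s = fun _ => q + Q *ᵥ ![0, 0, z s] := by
      funext θ
      rw [h.eq_rotate s hs' θ, ← heq, zero_mul, zero_mul]
    rw [h4] at h2
    have h5 := h2.unique (hasDerivAt_const _ _)
    have := hF.immersion (s, 0) (hdisc s hs') (h5.trans (map_zero _).symm)
    simp at this
    exact hs.1.ne' this
  · intro s hs
    simpa [(hray s hs).1] using h.nonneg s hs
  · intro s hs θ
    rw [h.eq_rotate s hs θ, (hray s hs).1]
    rfl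
  · simp [(hray 1 ⟨zero_le_one, le_rfl⟩).1]

/-! ### Differentiation of a variational integral -/

section

variable {E : Type*} [NormedAddCommGroup E] [NormedSpace ℝ E] {U : Set E} {x v : ℝ → E} {δ : ℝ}

lemma eventually_add_smul_mem (hU : IsOpen U) (hx : Continuous x) (hv : Continuous v)
    (hxU : ∀ s ∈ Icc δ 1, x s ∈ U) : ∀ᶠ t : ℝ in 𝓝 0, ∀ s ∈ Icc δ 1, x s + t • v s ∈ U := by
  have hn : IsOpen {p : ℝ × ℝ | x p.2 + p.1 • v p.2 ∈ U} :=
    hU.preimage (f := fun p : ℝ × ℝ => x p.2 + p.1 • v p.2) (by fun_prop)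
  obtain ⟨A, B, hA, hB, h0A, hIB, hAB⟩ := generalized_tube_lemma (isCompact_singleton (x := (0 : ℝ)))
    (isCompact_Icc (a := δ) (b := 1)) hn (by
      rintro ⟨t, s⟩ ⟨ht, hs⟩
      simp only [mem_singleton_iff] at ht
      subst ht
      simpa using hxU s hs)
  filter_upwards [hA.mem_nhds (h0A rfl)] with t ht s hs
  exact hAB (mk_mem_prod ht (hIB hs))

/-- For small `t` the perturbed curve stays in `U` uniformly over the compact interval, so the
`t`-derivative of the integrand is bounded by a constant there and differentiation under the
integral is allowed. -/
lemma hasDerivAt_variational {L : E → ℝ} (hU : IsOpen U) (hL : ContDiffOn ℝ 1 L U)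
    (hδ : δ ≤ 1) (hx : Continuous x) (hv : Continuous v) (hxU : ∀ s ∈ Icc δ 1, x s ∈ U) :
    HasDerivAt (fun t : ℝ => ∫ s in δ..1, L (x s + t • v s))
      (∫ s in δ..1, fderiv ℝ L (x s) (v s)) 0 := by
  obtain ⟨ε, hε, hball⟩ := Metric.nhds_basis_closedBall.eventually_iff.1
    (eventually_add_smul_mem hU hx hv hxU)
  have hmap : MapsTo (fun p : ℝ × ℝ => x p.2 + p.1 • v p.2)
      (Metric.closedBall 0 ε ×ˢ Icc δ 1) U := fun p hp => hball hp.1 p.2 hp.2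
  have hcont : ContinuousOn (fun p : ℝ × ℝ => fderiv ℝ L (x p.2 + p.1 • v p.2) (v p.2))
      (Metric.closedBall 0 ε ×ˢ Icc δ 1) := by
    have h1 := (hL.continuousOn_fderiv_of_isOpen hU le_rfl).comp
      (f := fun p : ℝ × ℝ => x p.2 + p.1 • v p.2) (by fun_prop) hmap
    exact h1.clm_apply (by fun_prop)
  obtain ⟨C, hC⟩ := ((isCompact_closedBall (0 : ℝ) ε).prod isCompact_Icc).exists_bound_of_continuousOn
    hcont
  have hslice : ∀ t ∈ Metric.closedBall (0 : ℝ) ε,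
      ContinuousOn (fun s => L (x s + t • v s)) (Icc δ 1) := fun t ht =>
    hL.continuousOn.comp (by fun_prop) fun s hs => hball ht s hs
  have h0 : (0 : ℝ) ∈ Metric.closedBall (0 : ℝ) ε := Metric.mem_closedBall_self hε.le
  have key := intervalIntegral.hasDerivAt_integral_of_dominated_loc_of_deriv_le
    (μ := MeasureTheory.volume) (a := δ) (b := 1) (bound := fun _ => C)
    (F := fun t s => L (x s + t • v s)) (F' := fun t s => fderiv ℝ L (x s + t • v s) (v s))
    (s := Metric.ball (0 : ℝ) ε) (x₀ := 0) (Metric.ball_mem_nhds _ hε) ?_ ?_ ?_ ?_ ?_ ?_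
  · simpa using key.2
  · filter_upwards [Metric.closedBall_mem_nhds (0 : ℝ) hε] with t ht
    rw [uIoc_of_le hδ]
    exact ((hslice t ht).mono Ioc_subset_Icc_self).aestronglyMeasurable measurableSet_Ioc
  · exact (hslice 0 h0).intervalIntegrable_of_Icc hδ
  · rw [uIoc_of_le hδ]
    refine ContinuousOn.aestronglyMeasurable (ContinuousOn.mono ?_ Ioc_subset_Icc_self)
      measurableSet_Ioc
    exact hcont.comp (f := fun s : ℝ => ((0 : ℝ), s)) (by fun_prop) fun s hs => ⟨h0, hs⟩
  · refine Eventually.of_forall fun s hs t ht => ?_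
    rw [uIoc_of_le hδ] at hs
    exact hC (t, s) ⟨Metric.ball_subset_closedBall ht, Ioc_subset_Icc_self hs⟩
  · exact intervalIntegrable_const
  · refine Eventually.of_forall fun s hs t ht => ?_
    rw [uIoc_of_le hδ] at hs
    have hmem := hball (Metric.ball_subset_closedBall ht) s (Ioc_subset_Icc_self hs)
    have h1 : HasDerivAt (fun t : ℝ => x s + t • v s) (v s) t := by
      simpa using ((hasDerivAt_id t).smul_const (v s)).const_add (x s)
    exact ((hL.differentiableOn one_ne_zero).differentiableAt
      (hU.mem_nhds hmem)).hasFDerivAt.comp_hasDerivAt t h1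

end

/-! ### The Lagrangian of the bending energy -/

/-- The bending density as a function of the jet `(r, r', r'', z', z'')`. -/
def lagrangian (a c : ℝ) (y : ℝ × ℝ × ℝ × ℝ × ℝ) : ℝ :=
  a * (((y.2.2.2.2 * y.2.1 - y.2.2.1 * y.2.2.2.1) / √(y.2.1 ^ 2 + y.2.2.2.1 ^ 2) ^ 3
    + y.2.2.2.1 / (y.1 * √(y.2.1 ^ 2 + y.2.2.2.1 ^ 2))) / 2 + c) ^ 2
    * (y.1 * √(y.2.1 ^ 2 + y.2.2.2.1 ^ 2))

/-- The jets of regular curves off the axis. -/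
def regularJets : Set (ℝ × ℝ × ℝ × ℝ × ℝ) := {y | 0 < y.1 ∧ 0 < y.2.1 ^ 2 + y.2.2.2.1 ^ 2}

lemma isOpen_regularJets : IsOpen regularJets := by
  have h1 : IsOpen {y : ℝ × ℝ × ℝ × ℝ × ℝ | 0 < y.1} := isOpen_lt (by fun_prop) (by fun_prop)
  have h2 : IsOpen {y : ℝ × ℝ × ℝ × ℝ × ℝ | 0 < y.2.1 ^ 2 + y.2.2.2.1 ^ 2} :=
    isOpen_lt (by fun_prop) (by fun_prop)
  exact h1.inter h2

lemma contDiffOn_lagrangian (a c : ℝ) : ContDiffOn ℝ 1 (lagrangian a c) regularJets := by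
  have hw : ContDiffOn ℝ 1 (fun y : ℝ × ℝ × ℝ × ℝ × ℝ => √(y.2.1 ^ 2 + y.2.2.2.1 ^ 2))
      regularJets := by
    refine ContDiffOn.sqrt ?_ fun y hy => hy.2.ne'
    exact ContDiff.contDiffOn (by fun_prop)
  have hx : ContDiffOn ℝ 1 (fun y : ℝ × ℝ × ℝ × ℝ × ℝ => y.1) regularJets :=
    ContDiff.contDiffOn (by fun_prop)
  have hq : ContDiffOn ℝ 1 (fun y : ℝ × ℝ × ℝ × ℝ × ℝ => y.2.2.2.1) regularJets :=
    ContDiff.contDiffOn (by fun_prop)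
  have hN : ContDiffOn ℝ 1
      (fun y : ℝ × ℝ × ℝ × ℝ × ℝ => y.2.2.2.2 * y.2.1 - y.2.2.1 * y.2.2.2.1) regularJets :=
    ContDiff.contDiffOn (by fun_prop)
  have hw0 : ∀ y ∈ regularJets, √(y.2.1 ^ 2 + y.2.2.2.1 ^ 2) ≠ 0 := fun y hy =>
    (Real.sqrt_pos.2 hy.2).ne'
  have h1 := hN.div (hw.pow 3) fun y hy => pow_ne_zero 3 (hw0 y hy)
  have h2 := hq.div (hx.mul hw) fun y hy => mul_ne_zero hy.1.ne' (hw0 y hy)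
  exact (contDiffOn_const.mul ((((h1.add h2).div_const 2).add contDiffOn_const).pow 2)).mul
    (hx.mul hw)

/-- The directional derivative of the Lagrangian, when the velocity vector `(p, q)` of the profile
curve is stretched at the rate `g` and turned at the rate `f`. -/
lemma fderiv_lagrangian {a c x p m q n f g f' g' ξ : ℝ} (hx : 0 < x) (hw : 0 < √(p ^ 2 + q ^ 2))
    {w k u : ℝ} (hwd : w = √(p ^ 2 + q ^ 2)) (hk : k = (n * p - m * q) / w ^ 3)
    (hu : u = (k + q / (x * w)) / 2 + c) :
    fderiv ℝ (lagrangian a c) (x, p, m, q, n) (ξ, p * g - q * f, m * g + p * g' - (n * f + q * f'),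
      q * g + p * f, n * g + q * g' + (m * f + p * f')) =
      a * u * x * f' + a * u * x * (p / x) * f + (a * u ^ 2 * (x * w) - a * u * x * k * w) * g
        + ξ * (a * u ^ 2 * w - a * u * (q / x)) := by
  have hw2 : w ^ 2 = p ^ 2 + q ^ 2 := by rw [hwd, Real.sq_sqrt (by positivity)]
  have hpq : 0 < p ^ 2 + q ^ 2 := Real.sqrt_pos.1 hw
  have hmem : ((x, p, m, q, n) : ℝ × ℝ × ℝ × ℝ × ℝ) ∈ regularJets := ⟨hx, hpq⟩
  have hw0 : 0 < w := hwd ▸ hw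
  set v : ℝ × ℝ × ℝ × ℝ × ℝ := (ξ, p * g - q * f, m * g + p * g' - (n * f + q * f'),
      q * g + p * f, n * g + q * g' + (m * f + p * f')) with hv
  -- The Fréchet derivative is read off along a line, which turns the claim into a one-variable
  -- computation.
  have hline : HasDerivAt (fun t : ℝ => ((x, p, m, q, n) : ℝ × ℝ × ℝ × ℝ × ℝ) + t • v) v 0 := by
    simpa using ((hasDerivAt_id (0 : ℝ)).smul_const v).const_add (x, p, m, q, n)
  have hfd : HasFDerivAt (lagrangian a c) (fderiv ℝ (lagrangian a c) (x, p, m, q, n))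
      (((x, p, m, q, n) : ℝ × ℝ × ℝ × ℝ × ℝ) + (0 : ℝ) • v) := by
    rw [zero_smul, add_zero]
    exact (((contDiffOn_lagrangian a c).differentiableOn one_ne_zero).differentiableAt
      (isOpen_regularJets.mem_nhds hmem)).hasFDerivAt
  have h1 := hfd.comp_hasDerivAt (0 : ℝ) hline
  have lin : ∀ y y' : ℝ, HasDerivAt (fun t : ℝ => y + t * y') y' 0 := fun y y' => by
    simpa using ((hasDerivAt_id (0 : ℝ)).mul_const y').const_add y
  have hW : HasDerivAt (fun t : ℝ => √((p + t * (p * g - q * f)) ^ 2 + (q + t * (q * g + p * f)) ^ 2))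
      (w * g) 0 := by
    have h := ((lin p (p * g - q * f)).fun_pow 2).fun_add ((lin q (q * g + p * f)).fun_pow 2)
    refine (h.sqrt (by simpa using hpq.ne')).congr_deriv ?_
    simp only [zero_mul, add_zero, ← hwd]
    field_simp
    rw [hw2]
    push_cast
    ring
  have hN := ((lin n (n * g + q * g' + (m * f + p * f'))).fun_mul (lin p (p * g - q * f))).fun_sub
    ((lin m (m * g + p * g' - (n * f + q * f'))).fun_mul (lin q (q * g + p * f)))
  have hK := hN.fun_div (hW.fun_pow 3) (by simpa using hw.ne')
  have hx' : x + 0 * ξ ≠ 0 := by simpa using hx.ne'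
  have hP := (lin q (q * g + p * f)).fun_div ((lin x ξ).fun_mul hW)
    (mul_ne_zero hx' (by simpa using hw.ne'))
  have hfin := ((((hK.fun_add hP).div_const 2).add_const c).fun_pow 2).const_mul a |>.fun_mul
    ((lin x ξ).fun_mul hW)
  have huniq := h1.unique (hfin.congr_of_eventuallyEq (Eventually.of_forall fun t => by
    simp [lagrangian, hv]))
  rw [huniq]
  simp only [zero_mul, add_zero, ← hwd]
  -- Variation of the meridian curvature: turning contributes the arc length derivative of `f`, and
  -- stretching scales curvature inversely.
  have e1 : (((n * g + q * g' + (m * f + p * f')) * p + n * (p * g - q * f) -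
      ((m * g + p * g' - (n * f + q * f')) * q + m * (q * g + p * f))) * w ^ 3 -
      (n * p - m * q) * (((3 : ℕ) : ℝ) * w ^ (3 - 1) * (w * g))) / (w ^ 3) ^ 2 = f' / w - k * g := by
    rw [hk]
    field_simp
    push_cast
    linear_combination (-f' * w ^ 2 ) * hw2
  have e2 : ((q * g + p * f) * (x * w) - q * (ξ * w + x * (w * g))) / (x * w) ^ 2 =
      p * f / (x * w) - q * ξ / (x ^ 2 * w) := by
    field_simp
    ring
  rw [e1, e2, ← hk, ← hu]
  field_simp
  push_cast
  ring

/-! ### Axially symmetric variations -/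

section Primitive

variable {h : ℝ → ℝ}

lemma hasDerivAt_primitive (hh : Continuous h) (s : ℝ) :
    HasDerivAt (fun s => ∫ x in (0 : ℝ)..s, h x) (h s) s :=
  intervalIntegral.integral_hasDerivAt_right (hh.intervalIntegrable _ _)
    hh.aestronglyMeasurable.stronglyMeasurableAtFilter hh.continuousAt

lemma contDiff_primitive (hh : ContDiff ℝ 3 h) :
    ContDiff ℝ 4 (fun s => ∫ x in (0 : ℝ)..s, h x) := by
  have hd : deriv (fun s => ∫ x in (0 : ℝ)..s, h x) = h :=
    funext fun s => (hasDerivAt_primitive hh.continuous s).deriv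
  have : ContDiff ℝ (3 + 1) (fun s => ∫ x in (0 : ℝ)..s, h x) := by
    rw [contDiff_succ_iff_deriv, hd]
    exact ⟨fun s => (hasDerivAt_primitive hh.continuous s).differentiableAt, by simp, hh⟩
  exact this

lemma primitive_eq_zero {δ s : ℝ} (hδ : 0 < δ) (h0 : ∀ x ≤ δ, h x = 0) (hs : s ≤ δ) :
    ∫ x in (0 : ℝ)..s, h x = 0 := by
  rw [intervalIntegral.integral_congr (g := fun _ => 0), intervalIntegral.integral_zero]
  intro x hx
  exact h0 x (hx.2.trans (max_le hδ.le hs))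

end Primitive

/-- The vector field with radial component `ξ` and axial component `η` in the frame `Q`. -/
def rotField (Q : Matrix (Fin 3) (Fin 3) ℝ) (ξ η : ℝ → ℝ) (p : ℝ × ℝ) : R3 :=
  Q *ᵥ ![ξ (√(p.1 ^ 2 + p.2 ^ 2)) / √(p.1 ^ 2 + p.2 ^ 2) * p.1,
    ξ (√(p.1 ^ 2 + p.2 ^ 2)) / √(p.1 ^ 2 + p.2 ^ 2) * p.2, η (√(p.1 ^ 2 + p.2 ^ 2))]

lemma polar_rotField (Q : Matrix (Fin 3) (Fin 3) ℝ) {ξ η : ℝ → ℝ} (h0 : ξ 0 = 0) {s : ℝ}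
    (hs : 0 ≤ s) (θ : ℝ) :
    rotField Q ξ η (s * Real.cos θ, s * Real.sin θ) =
      Q *ᵥ ![ξ s * Real.cos θ, ξ s * Real.sin θ, η s] := by
  have h1 : √((s * Real.cos θ) ^ 2 + (s * Real.sin θ) ^ 2) = s := by
    rw [← Real.sqrt_sq hs]
    congr 1
    rw [Real.sqrt_sq hs]
    linear_combination s ^ 2 * Real.sin_sq_add_cos_sq θ
  simp only [rotField, h1]
  rcases hs.eq_or_lt with rfl | hs
  · simp [h0]
  · congr 1
    ext i
    fin_cases i <;> simp <;> field_simp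

/-- Vanishing near the axis removes the singularity of polar coordinates; elsewhere the radius is
smooth. -/
lemma contDiff_rotField (Q : Matrix (Fin 3) (Fin 3) ℝ) {ξ η : ℝ → ℝ} (hξ : ContDiff ℝ 4 ξ)
    (hη : ContDiff ℝ 4 η) {δ : ℝ} (hδ : 0 < δ) (hξ0 : ∀ s ≤ δ, ξ s = 0)
    (hη0 : ∀ s ≤ δ, η s = 0) : ContDiff ℝ 4 (rotField Q ξ η) := by
  rw [contDiff_iff_contDiffAt]
  rintro ⟨x, y⟩
  by_cases hp : x ^ 2 + y ^ 2 = 0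
  · have hcont : Continuous fun p : ℝ × ℝ => √(p.1 ^ 2 + p.2 ^ 2) := by fun_prop
    have hev : ∀ᶠ p : ℝ × ℝ in 𝓝 (x, y), √(p.1 ^ 2 + p.2 ^ 2) < δ :=
      hcont.continuousAt.eventually_lt_const (by simpa [hp] using hδ)
    refine (contDiffAt_const (c := (0 : R3))).congr_of_eventuallyEq ?_
    filter_upwards [hev] with p hp
    simp only [rotField, hξ0 _ hp.le, hη0 _ hp.le]
    ext i
    simp [Matrix.mulVec, dotProduct, Fin.sum_univ_three]
  · have hw : ContDiffAt ℝ 4 (fun p : ℝ × ℝ => √(p.1 ^ 2 + p.2 ^ 2)) (x, y) :=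
      ContDiffAt.sqrt (ContDiff.contDiffAt (by fun_prop)) hp
    have hw0 : √(x ^ 2 + y ^ 2) ≠ 0 :=
      (Real.sqrt_pos.2 (lt_of_le_of_ne (by positivity) (Ne.symm hp))).ne'
    have h1 : ContDiffAt ℝ 4 (fun p : ℝ × ℝ => ξ (√(p.1 ^ 2 + p.2 ^ 2))) (x, y) :=
      hξ.contDiffAt.comp (x, y) hw
    have h2 : ContDiffAt ℝ 4 (fun p : ℝ × ℝ => η (√(p.1 ^ 2 + p.2 ^ 2))) (x, y) :=
      hη.contDiffAt.comp (x, y) hw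
    have h3 := h1.div hw hw0
    rw [contDiffAt_pi]
    intro i
    simp only [rotField, Matrix.mulVec, dotProduct, Fin.sum_univ_three, Matrix.cons_val_zero,
      Matrix.cons_val_one, Matrix.cons_val]
    exact ((contDiffAt_const.mul (h3.mul contDiffAt_fst)).add
      (contDiffAt_const.mul (h3.mul contDiffAt_snd))).add (contDiffAt_const.mul h2)

/-- The jet `(r, r', r'', z', z'')`. -/
def jet (r z : ℝ → ℝ) (s : ℝ) : ℝ × ℝ × ℝ × ℝ × ℝ :=
  (r s, deriv r s, deriv (deriv r) s, deriv z s, deriv (deriv z) s)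

lemma bendingDensity_eq_lagrangian (a c : ℝ) (r z : ℝ → ℝ) (s : ℝ) :
    bendingDensity a c r z s = lagrangian a c (jet r z s) := rfl

lemma deriv_add_mul {f g : ℝ → ℝ} (hf : Differentiable ℝ f) (hg : Differentiable ℝ g) (t : ℝ) :
    deriv (fun s => f s + t * g s) = fun s => deriv f s + t * deriv g s := by
  funext s
  exact ((hf s).hasDerivAt.add ((hg s).hasDerivAt.const_mul t)).deriv

lemma differentiable_deriv {f : ℝ → ℝ} (hf : ContDiff ℝ 4 f) : Differentiable ℝ (deriv f) :=
  (contDiff_deriv 3 hf).differentiable (by norm_num)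

lemma jet_add_mul {r z ξ η : ℝ → ℝ} (hr : ContDiff ℝ 4 r) (hz : ContDiff ℝ 4 z)
    (hξ : ContDiff ℝ 4 ξ) (hη : ContDiff ℝ 4 η) (t s : ℝ) :
    jet (fun s => r s + t * ξ s) (fun s => z s + t * η s) s = jet r z s + t • jet ξ η s := by
  have d : ∀ {f : ℝ → ℝ}, ContDiff ℝ 4 f → Differentiable ℝ f := fun hf =>
    hf.differentiable (by norm_num)
  have dd : ∀ {f : ℝ → ℝ}, ContDiff ℝ 4 f → Differentiable ℝ (deriv f) := differentiable_deriv
  simp only [jet, deriv_add_mul (d hr) (d hξ), deriv_add_mul (d hz) (d hη),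
    deriv_add_mul (dd hr) (dd hξ), deriv_add_mul (dd hz) (dd hη)]
  rfl

lemma continuous_jet {r z : ℝ → ℝ} (hr : ContDiff ℝ 4 r) (hz : ContDiff ℝ 4 z) :
    Continuous (jet r z) := by
  have h1 := hr.continuous
  have h2 := (contDiff_deriv 3 hr).continuous
  have h3 := (contDiff_deriv 2 (contDiff_deriv 3 hr)).continuous
  have h4 := (contDiff_deriv 3 hz).continuous
  have h5 := (contDiff_deriv 2 (contDiff_deriv 3 hz)).continuous
  unfold jet
  fun_prop

namespace RegularProfile

variable {r z ξ η : ℝ → ℝ} {δ : ℝ}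

lemma jet_mem (h : RegularProfile r z) {s : ℝ} (hs : s ∈ Ioc (0 : ℝ) 1) :
    jet r z s ∈ regularJets :=
  ⟨h.r_pos s hs, Real.sqrt_pos.1 (h.speed_pos s (Ioc_subset_Icc_self hs))⟩

/-- Nothing changes near the axis, and away from it the jets run through a compact part of the open
set of regular jets. -/
lemma eventually_add_mul (h : RegularProfile r z) (hξ : ContDiff ℝ 4 ξ) (hη : ContDiff ℝ 4 η)
    (hδ : 0 < δ) (hξ0 : ∀ s ≤ δ, ξ s = 0) (hη0 : ∀ s ≤ δ, η s = 0) :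
    ∀ᶠ t : ℝ in 𝓝 0, RegularProfile (fun s => r s + t * ξ s) (fun s => z s + t * η s) := by
  have hev := eventually_add_smul_mem (δ := δ / 2) isOpen_regularJets
    (continuous_jet h.contDiff_r h.contDiff_z) (continuous_jet hξ hη)
    (fun s hs => h.jet_mem ⟨by linarith [hs.1], hs.2⟩)
  filter_upwards [hev] with t ht
  have hloc : ∀ {f φ : ℝ → ℝ}, (∀ s ≤ δ, φ s = 0) → ∀ s < δ,
      (fun x => f x + t * φ x) =ᶠ[𝓝 s] f := fun {f φ} hφ s hs => by
    filter_upwards [Iio_mem_nhds hs] with x hx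
    rw [hφ x (le_of_lt hx), mul_zero, add_zero]
  have hsp : ∀ s < δ, speed (fun s => r s + t * ξ s) (fun s => z s + t * η s) s = speed r z s :=
    fun s hs => by
      rw [speed, speed, (hloc hξ0 s hs).deriv_eq, (hloc hη0 s hs).deriv_eq]
  refine ⟨h.contDiff_r.add (contDiff_const.mul hξ), h.contDiff_z.add (contDiff_const.mul hη),
    ?_, ?_, ?_, ?_, ?_⟩
  · simp [h.r_zero, hξ0 0 hδ.le]
  · rw [(hloc hξ0 0 hδ).deriv_eq]
    exact h.deriv_r_zero
  · rw [(hloc hη0 0 hδ).deriv_eq]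
    exact h.deriv_z_zero
  · intro s hs
    by_cases hsδ : s < δ
    · simpa [hξ0 s hsδ.le] using h.r_pos s hs
    · exact (ht s ⟨by linarith, hs.2⟩).1
  · intro s hs
    by_cases hsδ : s < δ
    · rw [hsp s hsδ]
      exact h.speed_pos s hs
    · have h1 := ht s ⟨by linarith, hs.2⟩
      rw [← jet_add_mul h.contDiff_r h.contDiff_z hξ hη] at h1
      exact Real.sqrt_pos.2 h1.2

/-- The part of the integral over `[0, δ]` does not depend on `t`, so the Lagrangian is never
differentiated at its singularity `r = 0`. -/
lemma hasDerivAt_bending (h : RegularProfile r z) (hξ : ContDiff ℝ 4 ξ) (hη : ContDiff ℝ 4 η)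
    (hδ : 0 < δ) (hδ1 : δ < 1) (hξ0 : ∀ s ≤ δ, ξ s = 0) (hη0 : ∀ s ≤ δ, η s = 0) (a c : ℝ) :
    HasDerivAt (fun t : ℝ => ∫ s in (0 : ℝ)..1,
        bendingDensity a c (fun s => r s + t * ξ s) (fun s => z s + t * η s) s)
      (∫ s in δ..1, fderiv ℝ (lagrangian a c) (jet r z s) (jet ξ η s)) 0 := by
  have h1 := hasDerivAt_variational isOpen_regularJets (contDiffOn_lagrangian a c) hδ1.le
    (continuous_jet h.contDiff_r h.contDiff_z) (continuous_jet hξ hη)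
    (fun s hs => h.jet_mem ⟨by linarith [hs.1], hs.2⟩)
  refine (h1.const_add (∫ s in (0 : ℝ)..δ, bendingDensity a c r z s)).congr_of_eventuallyEq ?_
  filter_upwards [h.eventually_add_mul hξ hη hδ hξ0 hη0] with t ht
  have hI := ht.intervalIntegrable_bendingDensity a c
  rw [← intervalIntegral.integral_add_adjacent_intervals (b := δ)
    (hI.mono_set (by rw [uIcc_of_le hδ.le, uIcc_of_le zero_le_one]; exact Icc_subset_Icc_right hδ1.le))
    (hI.mono_set (by rw [uIcc_of_le hδ1.le, uIcc_of_le zero_le_one]; exact Icc_subset_Icc_left hδ.le))]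
  congr 1
  · refine intervalIntegral.integral_congr_Ioo_of_le hδ.le fun s hs => ?_
    have hloc : ∀ {f φ : ℝ → ℝ}, (∀ s ≤ δ, φ s = 0) →
        (fun x => f x + t * φ x) =ᶠ[𝓝 s] f := fun {f φ} hφ => by
      filter_upwards [Iio_mem_nhds hs.2] with x hx
      rw [hφ x (le_of_lt hx), mul_zero, add_zero]
    have e1 := hloc (f := r) hξ0
    have e2 := hloc (f := z) hη0
    simp only [bendingDensity_eq_lagrangian, jet]
    rw [e1.deriv_eq, e2.deriv_eq, e1.deriv.deriv_eq, e2.deriv.deriv_eq, hξ0 s hs.2.le, mul_zero,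
      add_zero]
  · simp only [bendingDensity_eq_lagrangian,
      jet_add_mul h.contDiff_r h.contDiff_z hξ hη]

end RegularProfile

/-- The first variation of the energy in an axially symmetric direction vanishing near the
axis. -/
lemma IsRevolutionDisc.first_variation {F : ℝ × ℝ → R3} {Q : Matrix (Fin 3) (Fin 3) ℝ} {q : R3}
    {r z ξ η : ℝ → ℝ} {a c b α β δ f g : ℝ} (hF : IsRevolutionDisc F Q q r z)
    (h : RegularProfile r z)
    (hcrit : IsCritical a c b α β F) (hρ : r 1 ^ 2 * β = α) (hξ : ContDiff ℝ 4 ξ)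
    (hη : ContDiff ℝ 4 η) (hδ : 0 < δ) (hδ1 : δ < 1) (hξ0 : ∀ s ≤ δ, ξ s = 0)
    (hη0 : ∀ s ≤ δ, η s = 0) (hξ1 : deriv ξ 1 = deriv r 1 * g - deriv z 1 * f)
    (hη1 : deriv η 1 = deriv z 1 * g + deriv r 1 * f) :
    (∫ s in δ..1, fderiv ℝ (lagrangian a c) (jet r z s) (jet ξ η s))
      + b * (deriv z 1 / speed r z 1) * f = 0 := by
  have one_mem : (1 : ℝ) ∈ Ioc (0 : ℝ) 1 := ⟨zero_lt_one, le_rfl⟩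
  have hr1 := h.r_pos 1 one_mem
  have hw1 := h.speed_pos 1 (Ioc_subset_Icc_self one_mem)
  have hd : ∀ {f : ℝ → ℝ}, ContDiff ℝ 4 f → Differentiable ℝ f := fun hf =>
    hf.differentiable (by norm_num)
  have hev : ∀ᶠ t : ℝ in 𝓝 0, energy a c b α β (fun p => F p + t • rotField Q ξ η p) =
      2 * Real.pi * (∫ s in (0 : ℝ)..1,
        bendingDensity a c (fun s => r s + t * ξ s) (fun s => z s + t * η s) s)
      + 2 * Real.pi * b * (1 - (deriv r 1 + t * deriv ξ 1) /
        √((deriv r 1 + t * deriv ξ 1) ^ 2 + (deriv z 1 + t * deriv η 1) ^ 2))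
      + 2 * Real.pi * ((α * (1 / (r 1 + t * ξ 1)) ^ 2 + β) * (r 1 + t * ξ 1)) := by
    filter_upwards [h.eventually_add_mul hξ hη hδ hξ0 hη0] with t ht
    have hFt : IsRevolutionDisc (fun p => F p + t • rotField Q ξ η p) Q q
        (fun s => r s + t * ξ s) (fun s => z s + t * η s) := by
      refine ⟨hF.rotation, fun s hs => ?_, fun s hs θ => ?_⟩
      · rcases hs.1.eq_or_lt with rfl | h0
        · exact ht.r_zero.ge
        · exact (ht.r_pos s ⟨h0, hs.2⟩).le
      · have e1 := hF.eq_rotate s hs θ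
        have e2 := polar_rotField Q (η := η) (hξ0 0 hδ.le) hs.1 θ
        rw [polar] at e1 ⊢
        rw [e1, e2, add_assoc, ← Matrix.mulVec_smul, ← Matrix.mulVec_add]
        congr 2
        ext i
        fin_cases i <;> simp <;> ring
    rw [hFt.energy_eq ht, speed, deriv_add_mul (hd h.contDiff_r) (hd hξ),
      deriv_add_mul (hd h.contDiff_z) (hd hη)]
  have lin : ∀ y y' : ℝ, HasDerivAt (fun t : ℝ => y + t * y') y' 0 := fun y y' => by
    simpa using ((hasDerivAt_id (0 : ℝ)).mul_const y').const_add y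
  have hw0 : (deriv r 1 + 0 * deriv ξ 1) ^ 2 + (deriv z 1 + 0 * deriv η 1) ^ 2 ≠ 0 := by
    simpa using (Real.sqrt_pos.1 hw1).ne'
  have hW := (((lin (deriv r 1) (deriv ξ 1)).fun_pow 2).fun_add
    ((lin (deriv z 1) (deriv η 1)).fun_pow 2)).sqrt hw0
  have hC := (lin (deriv r 1) (deriv ξ 1)).fun_div hW
    (Real.sqrt_pos.2 (lt_of_le_of_ne (by positivity) hw0.symm)).ne'
  have hρ0 : r 1 + 0 * ξ 1 ≠ 0 := by simpa using hr1.ne'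
  have hB := ((((hasDerivAt_const (0 : ℝ) (1 : ℝ)).fun_div (lin (r 1) (ξ 1)) hρ0).fun_pow 2
    |>.const_mul α).add_const β).fun_mul (lin (r 1) (ξ 1))
  have hE := (((h.hasDerivAt_bending hξ hη hδ hδ1 hξ0 hη0 a c).const_mul (2 * Real.pi)).fun_add
    ((hC.const_sub 1).const_mul (2 * Real.pi * b))).fun_add (hB.const_mul (2 * Real.pi))
  have huniq := (hE.congr_of_eventuallyEq hev).unique
    (hcrit (rotField Q ξ η) (contDiff_rotField Q hξ hη hδ hξ0 hη0))
  have hsp : √(deriv r 1 ^ 2 + deriv z 1 ^ 2) = speed r z 1 := rfl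
  have hsq := speed_sq r z 1
  simp only [zero_mul, add_zero, hsp, hξ1, hη1] at huniq
  set I := ∫ s in δ..1, fderiv ℝ (lagrangian a c) (jet r z s) (jet ξ η s)
  have hpi : (2 * Real.pi) ≠ 0 := by positivity
  -- Stretching leaves the rim angle fixed; only the turning rate changes its cosine.
  have e1 : ((deriv r 1 * g - deriv z 1 * f) * speed r z 1 - deriv r 1 *
      ((((2 : ℕ) : ℝ) * deriv r 1 ^ (2 - 1) * (deriv r 1 * g - deriv z 1 * f) +
        ((2 : ℕ) : ℝ) * deriv z 1 ^ (2 - 1) * (deriv z 1 * g + deriv r 1 * f)) /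
          (2 * speed r z 1))) / speed r z 1 ^ 2 = -(deriv z 1 / speed r z 1 * f) := by
    push_cast
    field_simp
    rw [hsq]
    ring
  -- The prescribed radius is critical for `ρ ↦ α/ρ + βρ`, so the free value `ξ 1` contributes
  -- nothing.
  have e2 : α * (((2 : ℕ) : ℝ) * (1 / r 1) ^ (2 - 1) * ((0 - 1 * ξ 1) / r 1 ^ 2)) * r 1 +
      (α * (1 / r 1) ^ 2 + β) * ξ 1 = 0 := by
    rw [← hρ, show 2 - 1 = 1 from rfl]
    push_cast
    field_simp
    ring
  rw [e1, e2] at huniq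
  refine mul_left_cancel₀ hpi ?_
  linear_combination huniq

/-! ### The Euler-Lagrange equations -/

/-- The fundamental lemma of the calculus of variations for test functions that vanish near `0`
and at `1`. -/
lemma eq_zero_of_integral_test_eq_zero {h : ℝ → ℝ} (hc : ContinuousOn h (Ioc 0 1))
    (H : ∀ (f : ℝ → ℝ) (δ : ℝ), ContDiff ℝ 3 f → 0 < δ → δ < 1 → (∀ s ≤ δ, f s = 0) → f 1 = 0 →
      ∫ s in δ..1, h s * f s = 0) : ∀ s ∈ Ioc (0 : ℝ) 1, h s = 0 := by
  have hae := isOpen_Ioo.ae_eq_zero_of_integral_contDiff_smul_eq_zero (U := Ioo (0 : ℝ) 1) (f := h)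
    (μ := MeasureTheory.volume)
    ((hc.mono Ioo_subset_Ioc_self).locallyIntegrableOn measurableSet_Ioo) (by
    intro f hf hfc hfs
    have hf0 : ∀ x ∉ Ioo (0 : ℝ) 1, f x = 0 := fun x hx => by
      by_contra hne
      exact hx (hfs (subset_tsupport f hne))
    have h0 : (0 : ℝ) ∈ (tsupport f)ᶜ := fun h0 => by simpa using hfs h0
    obtain ⟨ε, hε, hball⟩ := Metric.isOpen_iff.1 (isClosed_tsupport f).isOpen_compl 0 h0
    have hδ : ∀ s ≤ min (ε / 2) (1 / 2), f s = 0 := by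
      intro s hs
      by_cases hs0 : s ≤ 0
      · exact hf0 s fun h => absurd h.1 (not_lt.2 hs0)
      · by_contra hne
        refine hball ?_ (subset_tsupport f hne)
        rw [Metric.mem_ball, dist_zero_right, Real.norm_of_nonneg (not_le.1 hs0).le]
        linarith [hs.trans (min_le_left _ _)]
    have hδ0 : 0 < min (ε / 2) (1 / 2) := by positivity
    have hδ1 : min (ε / 2) (1 / 2) < 1 := (min_le_right _ _).trans_lt (by norm_num)
    have key := H f _ (by exact_mod_cast contDiff_infty.1 hf 3) hδ0 hδ1 hδ (hf0 1 (by simp))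
    rw [intervalIntegral.integral_of_le hδ1.le] at key
    rw [← key, ← MeasureTheory.setIntegral_eq_integral_of_forall_compl_eq_zero
      (s := Ioc (min (ε / 2) (1 / 2)) 1)]
    · simp only [smul_eq_mul, mul_comm]
    · intro x hx
      have : f x = 0 := by
        by_cases h1 : x ≤ min (ε / 2) (1 / 2)
        · exact hδ x h1
        · exact hf0 x fun h2 => hx ⟨not_le.1 h1, h2.2.le⟩
      rw [this, zero_smul])
  have hres : h =ᵐ[MeasureTheory.volume.restrict (Ioo 0 1)] fun _ => (0 : ℝ) :=
    (MeasureTheory.ae_restrict_iff' measurableSet_Ioo).2 hae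
  have hIoo : EqOn h (fun _ => 0) (Ioo 0 1) :=
    MeasureTheory.Measure.eqOn_open_of_ae_eq hres isOpen_Ioo (hc.mono Ioo_subset_Ioc_self)
      continuousOn_const
  have hcl := hIoo.of_subset_closure hc continuousOn_const Ioo_subset_Ioc_self
    (by rw [closure_Ioo zero_ne_one]; exact Ioc_subset_Icc_self)
  exact fun s hs => hcl hs

/-- The momentum conjugate to the tangent angle of the profile curve. -/
def momentum (a c : ℝ) (r z : ℝ → ℝ) (s : ℝ) : ℝ := a * shiftedMean c r z s * r s

/-- The partial derivative of the bending density in the radius. -/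
def radialForce (a c : ℝ) (r z : ℝ → ℝ) (s : ℝ) : ℝ :=
  a * shiftedMean c r z s ^ 2 * speed r z s - a * shiftedMean c r z s * (deriv z s / r s)

/-- The Lagrange multiplier of the constraint that couples the radius to the tangent angle. -/
def multiplier (a c : ℝ) (r z : ℝ → ℝ) (s : ℝ) : ℝ := ∫ x in (1 : ℝ)..s, radialForce a c r z x

/-- The parameters where the profile curve is regular and off the axis. -/
def regularSet (r z : ℝ → ℝ) : Set ℝ := {s | 0 < r s ∧ 0 < speed r z s}

namespace RegularProfile

variable {r z : ℝ → ℝ}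

lemma isOpen_regularSet (h : RegularProfile r z) : IsOpen (regularSet r z) :=
  (isOpen_lt continuous_const h.contDiff_r.continuous).inter
    (isOpen_lt continuous_const h.continuous_speed)

lemma Ioc_subset_regularSet (h : RegularProfile r z) : Ioc 0 1 ⊆ regularSet r z := fun s hs =>
  ⟨h.r_pos s hs, h.speed_pos s (Ioc_subset_Icc_self hs)⟩

lemma contDiffOn_speed (h : RegularProfile r z) : ContDiffOn ℝ 1 (speed r z) (regularSet r z) := by
  have h1 : ContDiff ℝ 1 (deriv r) := h.contDiff_deriv_r.of_le (by norm_num)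
  have h2 : ContDiff ℝ 1 (deriv z) := h.contDiff_deriv_z.of_le (by norm_num)
  exact ((h1.pow 2).add (h2.pow 2)).contDiffOn.sqrt fun s hs => (Real.sqrt_pos.1 hs.2).ne'

lemma contDiffOn_shiftedMean (h : RegularProfile r z) (c : ℝ) :
    ContDiffOn ℝ 1 (shiftedMean c r z) (regularSet r z) := by
  have h0 : ContDiff ℝ 1 r := h.contDiff_r.of_le (by norm_num)
  have h1 : ContDiff ℝ 1 (deriv r) := h.contDiff_deriv_r.of_le (by norm_num)
  have h2 : ContDiff ℝ 1 (deriv z) := h.contDiff_deriv_z.of_le (by norm_num)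
  have h3 : ContDiff ℝ 1 (deriv (deriv r)) := h.contDiff_deriv2_r.of_le (by norm_num)
  have h4 : ContDiff ℝ 1 (deriv (deriv z)) := h.contDiff_deriv2_z.of_le (by norm_num)
  have hw := h.contDiffOn_speed
  have hk1 := ((h4.mul h1).sub (h3.mul h2)).contDiffOn.div (hw.pow 3)
    fun s hs => pow_ne_zero 3 hs.2.ne'
  have hk2 := h2.contDiffOn.div (h0.contDiffOn.mul hw) fun s hs => (mul_pos hs.1 hs.2).ne'
  exact ((hk1.add hk2).div_const 2).add contDiffOn_const

lemma contDiffOn_momentum (h : RegularProfile r z) (a c : ℝ) :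
    ContDiffOn ℝ 1 (momentum a c r z) (regularSet r z) :=
  (contDiffOn_const.mul (h.contDiffOn_shiftedMean c)).mul
    (h.contDiff_r.of_le (by norm_num)).contDiffOn

lemma hasDerivAt_momentum (h : RegularProfile r z) (a c : ℝ) {s : ℝ} (hs : s ∈ Ioc (0 : ℝ) 1) :
    HasDerivAt (momentum a c r z) (deriv (momentum a c r z) s) s :=
  (((h.contDiffOn_momentum a c).differentiableOn one_ne_zero).differentiableAt
    (h.isOpen_regularSet.mem_nhds (h.Ioc_subset_regularSet hs))).hasDerivAt

lemma continuousOn_deriv_momentum (h : RegularProfile r z) (a c : ℝ) :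
    ContinuousOn (deriv (momentum a c r z)) (Ioc 0 1) :=
  ((h.contDiffOn_momentum a c).continuousOn_deriv_of_isOpen h.isOpen_regularSet le_rfl).mono
    h.Ioc_subset_regularSet

lemma continuousOn_radialForce (h : RegularProfile r z) (a c : ℝ) :
    ContinuousOn (radialForce a c r z) (regularSet r z) := by
  have h1 := (h.contDiffOn_shiftedMean c).continuousOn
  have h2 := h.contDiff_r.continuous
  have h3 := h.continuous_speed
  have h4 := h.contDiff_deriv_z.continuous
  have h5 : ContinuousOn (fun s => deriv z s / r s) (regularSet r z) :=
    ContinuousOn.div (by fun_prop) (by fun_prop) fun s hs => hs.1.ne'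
  unfold radialForce
  fun_prop

lemma hasDerivAt_multiplier (h : RegularProfile r z) (a c : ℝ) {s : ℝ}
    (hs : s ∈ Ioc (0 : ℝ) 1) :
    HasDerivAt (multiplier a c r z) (radialForce a c r z s) s := by
  have hc := h.continuousOn_radialForce a c
  have hmem := h.Ioc_subset_regularSet hs
  refine intervalIntegral.integral_hasDerivAt_right ?_
    (hc.stronglyMeasurableAtFilter h.isOpen_regularSet s hmem)
    (hc.continuousAt (h.isOpen_regularSet.mem_nhds hmem))
  refine (hc.mono fun x hx => h.Ioc_subset_regularSet ?_).intervalIntegrable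
  rw [uIcc_of_ge hs.2] at hx
  exact ⟨hs.1.trans_le hx.1, hx.2⟩

lemma continuousOn_multiplier (h : RegularProfile r z) (a c : ℝ) :
    ContinuousOn (multiplier a c r z) (Ioc 0 1) := fun _ hs =>
  (h.hasDerivAt_multiplier a c hs).continuousAt.continuousWithinAt

end RegularProfile

/-- The rate of change of the momentum prescribed by the Euler-Lagrange equation for rotations of
the tangent. -/
def turningForce (a c : ℝ) (r z : ℝ → ℝ) (s : ℝ) : ℝ :=
  momentum a c r z s * (deriv r s / r s) + multiplier a c r z s * deriv z s

/-- The Hamiltonian of the bending energy. -/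
def hamiltonian (a c : ℝ) (r z : ℝ → ℝ) (s : ℝ) : ℝ :=
  a * shiftedMean c r z s ^ 2 * (r s * speed r z s)
    - momentum a c r z s * meridianCurv r z s * speed r z s - multiplier a c r z s * deriv r s

section EulerLagrange

variable {F : ℝ × ℝ → R3} {Q : Matrix (Fin 3) (Fin 3) ℝ} {q : R3} {r z : ℝ → ℝ} {a c b α β : ℝ}

/-- The displacement is recovered from the rates `f`, `g` by integrating outward from the axis.
Height enters the Lagrangian only through its derivatives, so only the radial displacement needs a
multiplier; two integrations by parts then leave `f` and `g` undifferentiated. -/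
lemma IsRevolutionDisc.weak_eulerLagrange (hF : IsRevolutionDisc F Q q r z)
    (h : RegularProfile r z) (hcrit : IsCritical a c b α β F) (hρ : r 1 ^ 2 * β = α)
    {f g : ℝ → ℝ} {δ : ℝ} (hf : ContDiff ℝ 3 f) (hg : ContDiff ℝ 3 g) (hδ : 0 < δ) (hδ1 : δ < 1)
    (hf0 : ∀ s ≤ δ, f s = 0) (hg0 : ∀ s ≤ δ, g s = 0) :
    (∫ s in δ..1, ((turningForce a c r z s - deriv (momentum a c r z) s) * f s
      + hamiltonian a c r z s * g s))
      + (momentum a c r z 1 + b * (deriv z 1 / speed r z 1)) * f 1 = 0 := by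
  have hr' := h.contDiff_deriv_r
  have hz' := h.contDiff_deriv_z
  have hξ' : ContDiff ℝ 3 (fun x => deriv r x * g x - deriv z x * f x) :=
    (hr'.mul hg).sub (hz'.mul hf)
  have hη' : ContDiff ℝ 3 (fun x => deriv z x * g x + deriv r x * f x) :=
    (hz'.mul hg).add (hr'.mul hf)
  set ξ : ℝ → ℝ := fun s => ∫ x in (0 : ℝ)..s, (deriv r x * g x - deriv z x * f x) with hξd
  set η : ℝ → ℝ := fun s => ∫ x in (0 : ℝ)..s, (deriv z x * g x + deriv r x * f x) with hηd
  have dξ : ∀ s, HasDerivAt ξ (deriv r s * g s - deriv z s * f s) s :=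
    hasDerivAt_primitive hξ'.continuous
  have dη : ∀ s, HasDerivAt η (deriv z s * g s + deriv r s * f s) s :=
    hasDerivAt_primitive hη'.continuous
  have hξ0 : ∀ s ≤ δ, ξ s = 0 := fun s hs =>
    primitive_eq_zero hδ (fun x hx => by rw [hf0 x hx, hg0 x hx]; ring) hs
  have hη0 : ∀ s ≤ δ, η s = 0 := fun s hs =>
    primitive_eq_zero hδ (fun x hx => by rw [hf0 x hx, hg0 x hx]; ring) hs
  have hvar := hF.first_variation (f := f 1) (g := g 1) h hcrit hρ (contDiff_primitive hξ')
    (contDiff_primitive hη') hδ hδ1 hξ0 hη0 (dξ 1).deriv (dη 1).deriv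
  have dξ1 : deriv ξ = fun s => deriv r s * g s - deriv z s * f s := funext fun s => (dξ s).deriv
  have dη1 : deriv η = fun s => deriv z s * g s + deriv r s * f s := funext fun s => (dη s).deriv
  have df : ∀ s, HasDerivAt f (deriv f s) s := fun s =>
    (hf.differentiable (by norm_num) s).hasDerivAt
  have dg : ∀ s, HasDerivAt g (deriv g s) s := fun s =>
    (hg.differentiable (by norm_num) s).hasDerivAt
  have hjet : ∀ s, jet ξ η s = (ξ s, deriv r s * g s - deriv z s * f s,
      deriv (deriv r) s * g s + deriv r s * deriv g s
        - (deriv (deriv z) s * f s + deriv z s * deriv f s),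
      deriv z s * g s + deriv r s * f s,
      deriv (deriv z) s * g s + deriv z s * deriv g s
        + (deriv (deriv r) s * f s + deriv r s * deriv f s)) := by
    intro s
    simp only [jet, dξ1, dη1]
    rw [(((h.hasDerivAt_deriv_r s).fun_mul (dg s)).fun_sub
        ((h.hasDerivAt_deriv_z s).fun_mul (df s))).deriv,
      (((h.hasDerivAt_deriv_z s).fun_mul (dg s)).fun_add
        ((h.hasDerivAt_deriv_r s).fun_mul (df s))).deriv]
  have hmem : ∀ s ∈ Icc δ 1, s ∈ Ioc (0 : ℝ) 1 := fun s hs => ⟨hδ.trans_le hs.1, hs.2⟩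
  -- The first bracket is the derivative of `momentum * f + ξ * multiplier`; what remains is the
  -- Euler–Lagrange expression.
  have hfd : ∀ s ∈ Icc δ 1, fderiv ℝ (lagrangian a c) (jet r z s) (jet ξ η s) =
      (deriv (momentum a c r z) s * f s + momentum a c r z s * deriv f s
        + ((deriv r s * g s - deriv z s * f s) * multiplier a c r z s
          + ξ s * radialForce a c r z s))
      + ((turningForce a c r z s - deriv (momentum a c r z) s) * f s
        + hamiltonian a c r z s * g s) := by
    intro s hs
    have hs' := hmem s hs
    rw [hjet]
    simp only [jet]
    rw [fderiv_lagrangian (h.r_pos s hs') (h.speed_pos s (Ioc_subset_Icc_self hs'))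
      (w := speed r z s) (k := meridianCurv r z s) (u := shiftedMean c r z s) rfl rfl rfl]
    simp only [turningForce, hamiltonian, radialForce, momentum]
    ring
  have hsub : Icc δ 1 ⊆ Ioc (0 : ℝ) 1 := hmem
  have c1 := (h.continuousOn_deriv_momentum a c).mono hsub
  have c2 : ContinuousOn (momentum a c r z) (Icc δ 1) :=
    (h.contDiffOn_momentum a c).continuousOn.mono (hsub.trans h.Ioc_subset_regularSet)
  have c3 := (h.continuousOn_multiplier a c).mono hsub
  have c4 := (h.continuousOn_radialForce a c).mono (hsub.trans h.Ioc_subset_regularSet)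
  have c5 := (h.continuousOn_shiftedMean c).mono hsub
  have c6 : ContinuousOn (meridianCurv r z) (Icc δ 1) :=
    h.continuousOn_meridianCurv.mono (hsub.trans Ioc_subset_Icc_self)
  have c7 := h.continuous_speed
  have c8 := hr'.continuous
  have c9 := hz'.continuous
  have c10 := h.contDiff_r.continuous
  have c11 := hf.continuous
  have c12 := hg.continuous
  have c13 : Continuous (deriv f) := (contDiff_deriv 2 hf).continuous
  have c14 : Continuous ξ := (contDiff_primitive hξ').continuous
  have c15 : ContinuousOn (fun s => deriv r s / r s) (Icc δ 1) :=
    ContinuousOn.div (by fun_prop) (by fun_prop) fun s hs => (h.r_pos s (hmem s hs)).ne'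
  have i1 : ContinuousOn (fun s => deriv (momentum a c r z) s * f s
      + momentum a c r z s * deriv f s
        + ((deriv r s * g s - deriv z s * f s) * multiplier a c r z s
          + ξ s * radialForce a c r z s)) (Icc δ 1) := by fun_prop
  have i2 : ContinuousOn (fun s => (turningForce a c r z s - deriv (momentum a c r z) s) * f s
        + hamiltonian a c r z s * g s) (Icc δ 1) := by
    unfold turningForce hamiltonian
    fun_prop
  have hftc := intervalIntegral.integral_eq_sub_of_hasDerivAt (a := δ) (b := 1)
    (f := fun s => momentum a c r z s * f s + ξ s * multiplier a c r z s)
    (fun s hs => by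
      rw [uIcc_of_le hδ1.le] at hs
      exact ((h.hasDerivAt_momentum a c (hmem s hs)).mul (df s)).add
        ((dξ s).mul (h.hasDerivAt_multiplier a c (hmem s hs))))
    (i1.intervalIntegrable_of_Icc hδ1.le)
  rw [intervalIntegral.integral_congr (fun s hs => hfd s (by rwa [uIcc_of_le hδ1.le] at hs)),
    intervalIntegral.integral_add (i1.intervalIntegrable_of_Icc hδ1.le)
      (i2.intervalIntegrable_of_Icc hδ1.le), hftc, hf0 δ le_rfl, hξ0 δ le_rfl] at hvar
  -- The multiplier is based at `1` because `ξ 1` is free: its boundary term must vanish there.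
  have hm1 : multiplier a c r z 1 = 0 := intervalIntegral.integral_same
  rw [hm1] at hvar
  linear_combination hvar

/-- Pure stretching, `f = 0`, leaves no boundary term. As the stretching rate is arbitrary, the
Hamiltonian is zero and not merely constant. -/
lemma IsRevolutionDisc.hamiltonian_eq_zero (hF : IsRevolutionDisc F Q q r z)
    (h : RegularProfile r z) (hcrit : IsCritical a c b α β F) (hρ : r 1 ^ 2 * β = α) :
    ∀ s ∈ Ioc (0 : ℝ) 1, hamiltonian a c r z s = 0 := by
  refine eq_zero_of_integral_test_eq_zero ?_ fun f δ hf hδ hδ1 hf0 _ => ?_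
  · have c2 : ContinuousOn (momentum a c r z) (Ioc 0 1) :=
      (h.contDiffOn_momentum a c).continuousOn.mono h.Ioc_subset_regularSet
    have c3 := h.continuousOn_multiplier a c
    have c5 := h.continuousOn_shiftedMean c
    have c6 : ContinuousOn (meridianCurv r z) (Ioc 0 1) :=
      h.continuousOn_meridianCurv.mono Ioc_subset_Icc_self
    have c7 := h.continuous_speed
    have c8 := h.contDiff_deriv_r.continuous
    have c10 := h.contDiff_r.continuous
    unfold hamiltonian
    fun_prop
  · simpa using hF.weak_eulerLagrange h hcrit hρ (f := fun _ => 0) contDiff_const hf hδ hδ1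
      (fun _ _ => rfl) hf0

lemma IsRevolutionDisc.deriv_momentum_eq (hF : IsRevolutionDisc F Q q r z)
    (h : RegularProfile r z) (hcrit : IsCritical a c b α β F) (hρ : r 1 ^ 2 * β = α) :
    ∀ s ∈ Ioc (0 : ℝ) 1, deriv (momentum a c r z) s = turningForce a c r z s := by
  suffices H : ∀ s ∈ Ioc (0 : ℝ) 1,
      turningForce a c r z s - deriv (momentum a c r z) s = 0 from
    fun s hs => (sub_eq_zero.1 (H s hs)).symm
  refine eq_zero_of_integral_test_eq_zero ?_ fun f δ hf hδ hδ1 hf0 hf1 => ?_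
  · have c1 := h.continuousOn_deriv_momentum a c
    have c2 : ContinuousOn (momentum a c r z) (Ioc 0 1) :=
      (h.contDiffOn_momentum a c).continuousOn.mono h.Ioc_subset_regularSet
    have c3 := h.continuousOn_multiplier a c
    have c8 := h.contDiff_deriv_r.continuous
    have c9 := h.contDiff_deriv_z.continuous
    have c10 := h.contDiff_r.continuous
    have c15 : ContinuousOn (fun s => deriv r s / r s) (Ioc 0 1) :=
      ContinuousOn.div (by fun_prop) (by fun_prop) fun s hs => (h.r_pos s hs).ne'
    unfold turningForce
    fun_prop
  · simpa [hf1] using hF.weak_eulerLagrange h hcrit hρ (g := fun _ => 0) hf contDiff_const hδ hδ1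
      hf0 (fun _ _ => rfl)

/-- A smooth function that vanishes near `0` and equals `1` at `1`. -/
lemma exists_cutoff : ∃ f : ℝ → ℝ, ContDiff ℝ 3 f ∧ (∀ s ≤ 1 / 2, f s = 0) ∧ f 1 = 1 := by
  refine ⟨fun s => Real.smoothTransition (2 * s - 1),
    (Real.smoothTransition.contDiff (n := 3)).comp (by fun_prop), fun s hs => ?_, ?_⟩
  · exact Real.smoothTransition.zero_of_nonpos (by linarith)
  · norm_num [Real.smoothTransition.one]

/-- Once the turning equation holds inside, a cutoff with `f 1 = 1` isolates the boundary
coefficient. -/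
lemma IsRevolutionDisc.natural_boundary (hF : IsRevolutionDisc F Q q r z)
    (h : RegularProfile r z) (hcrit : IsCritical a c b α β F) (hρ : r 1 ^ 2 * β = α) :
    momentum a c r z 1 + b * (deriv z 1 / speed r z 1) = 0 := by
  obtain ⟨f, hf, hf0, hf1⟩ := exists_cutoff
  have key := hF.weak_eulerLagrange h hcrit hρ (g := fun _ => 0) hf contDiff_const one_half_pos
    one_half_lt_one hf0 (fun _ _ => rfl)
  rw [intervalIntegral.integral_congr (g := fun _ => 0), intervalIntegral.integral_zero, hf1] at key
  · linarith
  · intro s hs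
    rw [uIcc_of_le one_half_lt_one.le] at hs
    have hs' : s ∈ Ioc (0 : ℝ) 1 := ⟨one_half_pos.trans_le hs.1, hs.2⟩
    simp [hF.deriv_momentum_eq h hcrit hρ s hs']

/-- The boundary value of `H + c` on a critical disc: either it vanishes or it is the curvature of
the profile curve. -/
lemma IsRevolutionDisc.shiftedMean_boundary (hF : IsRevolutionDisc F Q q r z)
    (h : RegularProfile r z) (ha : 0 < a) (hcrit : IsCritical a c b α β F)
    (hρ : r 1 ^ 2 * β = α) :
    shiftedMean c r z 1 = 0 ∨ shiftedMean c r z 1 = meridianCurv r z 1 := by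
  have one_mem : (1 : ℝ) ∈ Ioc (0 : ℝ) 1 := ⟨zero_lt_one, le_rfl⟩
  have hH := hF.hamiltonian_eq_zero h hcrit hρ 1 one_mem
  have hm1 : multiplier a c r z 1 = 0 := intervalIntegral.integral_same
  have hr := h.r_pos 1 one_mem
  have hw := h.speed_pos 1 (Ioc_subset_Icc_self one_mem)
  rw [hamiltonian, hm1, momentum] at hH
  -- With zero multiplier the Hamiltonian factors at the rim.
  have h1 : (a * r 1 * speed r z 1) *
      (shiftedMean c r z 1 * (shiftedMean c r z 1 - meridianCurv r z 1)) = 0 := by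
    linear_combination hH
  rcases mul_eq_zero.1 h1 with h2 | h2
  · exact absurd h2 (by positivity)
  · rcases mul_eq_zero.1 h2 with h3 | h3
    · exact Or.inl h3
    · exact Or.inr (sub_eq_zero.1 h3)

end EulerLagrange

/-! ### Critical discs on whose boundary `H + c` vanishes -/

/-- Uniqueness for a linear system with zero data at `1`. -/
lemma eq_zero_of_linear_system {P l A B D : ℝ → ℝ}
    (hP : ∀ s ∈ Ioc (0 : ℝ) 1, HasDerivAt P (P s * A s + l s * B s) s)
    (hl : ∀ s ∈ Ioc (0 : ℝ) 1, HasDerivAt l (P s * D s) s)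
    (hA : ContinuousOn A (Ioc 0 1)) (hB : ContinuousOn B (Ioc 0 1))
    (hD : ContinuousOn D (Ioc 0 1)) (hP1 : P 1 = 0) (hl1 : l 1 = 0) :
    ∀ s ∈ Ioc (0 : ℝ) 1, P s = 0 := by
  intro s₀ hs₀
  have hsub : Icc s₀ 1 ⊆ Ioc (0 : ℝ) 1 := fun s hs => ⟨hs₀.1.trans_le hs.1, hs.2⟩
  obtain ⟨M₁, hM₁⟩ := isCompact_Icc.exists_bound_of_continuousOn (hA.mono hsub)
  obtain ⟨M₂, hM₂⟩ := isCompact_Icc.exists_bound_of_continuousOn ((hB.add hD).mono hsub)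
  have hM₁0 : 0 ≤ M₁ := (norm_nonneg _).trans (hM₁ 1 ⟨hs₀.2, le_rfl⟩)
  -- A Grönwall weight: `2(P²A + Pl(B + D)) ≥ -2M₁P² - M₂(P² + l²)`, so the rate `2M₁ + M₂` makes
  -- the weighted square nondecreasing. It is nonnegative and ends at zero.
  have hder : ∀ s ∈ Icc s₀ 1, HasDerivAt
      (fun s => (P s ^ 2 + l s ^ 2) * Real.exp ((2 * M₁ + M₂) * s))
      ((2 * (P s ^ 2 * A s + P s * l s * (B s + D s)) + (2 * M₁ + M₂) * (P s ^ 2 + l s ^ 2))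
        * Real.exp ((2 * M₁ + M₂) * s)) s := by
    intro s hs
    have h1 := ((hP s (hsub hs)).fun_pow 2).fun_add ((hl s (hsub hs)).fun_pow 2)
    have h2 := ((hasDerivAt_id s).const_mul (2 * M₁ + M₂)).exp
    refine (h1.fun_mul h2).congr_deriv ?_
    simp only [id]
    push_cast
    ring
  have hmono : MonotoneOn (fun s => (P s ^ 2 + l s ^ 2) * Real.exp ((2 * M₁ + M₂) * s))
      (Icc s₀ 1) := by
    refine monotoneOn_of_deriv_nonneg (convex_Icc _ _)
      (fun s hs => (hder s hs).continuousAt.continuousWithinAt)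
      (fun s hs => (hder s (interior_subset hs)).differentiableAt.differentiableWithinAt)
      fun s hs => ?_
    have hs' := interior_subset hs
    rw [(hder s hs').deriv]
    refine mul_nonneg ?_ (Real.exp_pos _).le
    have b1 := abs_le.1 (hM₁ s hs')
    have b2 := abs_le.1 (hM₂ s hs')
    simp only [Pi.add_apply] at b2
    nlinarith [mul_nonneg (sq_nonneg (P s)) (by linarith [b1.1] : 0 ≤ A s + M₁),
      mul_nonneg hM₁0 (sq_nonneg (l s)),
      mul_nonneg (sq_nonneg (P s + l s)) (by linarith [b2.1] : 0 ≤ (B s + D s) + M₂),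
      mul_nonneg (sq_nonneg (P s - l s)) (by linarith [b2.2] : 0 ≤ M₂ - (B s + D s))]
  have hle := hmono ⟨le_rfl, hs₀.2⟩ ⟨hs₀.2, le_rfl⟩ hs₀.2
  simp only [hP1, hl1] at hle
  norm_num at hle
  have : P s₀ ^ 2 + l s₀ ^ 2 ≤ 0 := by
    by_contra hpos
    exact absurd hle (not_le.2 (mul_pos (not_le.1 hpos) (Real.exp_pos _)))
  nlinarith [sq_nonneg (P s₀), sq_nonneg (l s₀)]

section

variable {F : ℝ × ℝ → R3} {Q : Matrix (Fin 3) (Fin 3) ℝ} {q : R3} {r z : ℝ → ℝ} {a c b α β : ℝ}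

/-- The radial force has `H + c` as a factor, hence is the momentum times a coefficient continuous
off the axis. The coefficients may depend on the given solution, so the nonlinear equations are used
as a homogeneous linear system. -/
lemma IsRevolutionDisc.shiftedMean_eq_zero (hF : IsRevolutionDisc F Q q r z)
    (h : RegularProfile r z) (ha : 0 < a) (hcrit : IsCritical a c b α β F)
    (hρ : r 1 ^ 2 * β = α) (h1 : shiftedMean c r z 1 = 0) :
    ∀ s ∈ Ioc (0 : ℝ) 1, shiftedMean c r z s = 0 := by
  have c5 := h.continuousOn_shiftedMean c
  have c7 := h.continuous_speed
  have c8 := h.contDiff_deriv_r.continuous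
  have c9 := h.contDiff_deriv_z.continuous
  have c10 := h.contDiff_r.continuous
  have hr0 : ∀ s ∈ Ioc (0 : ℝ) 1, r s ≠ 0 := fun s hs => (h.r_pos s hs).ne'
  have key := eq_zero_of_linear_system (P := momentum a c r z) (l := multiplier a c r z)
    (A := fun s => deriv r s / r s) (B := deriv z)
    (D := fun s => (shiftedMean c r z s * speed r z s - deriv z s / r s) / r s)
    (fun s hs => (h.hasDerivAt_momentum a c hs).congr_deriv
      (hF.deriv_momentum_eq h hcrit hρ s hs))
    (fun s hs => (h.hasDerivAt_multiplier a c hs).congr_deriv (by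
      have := hr0 s hs
      rw [radialForce, momentum]
      field_simp))
    (ContinuousOn.div (by fun_prop) (by fun_prop) hr0) (by fun_prop)
    (ContinuousOn.div (ContinuousOn.sub (by fun_prop)
      (ContinuousOn.div (by fun_prop) (by fun_prop) hr0)) (by fun_prop) hr0)
    (by rw [momentum, h1]; ring) intervalIntegral.integral_same
  intro s hs
  have h2 := key s hs
  rw [momentum] at h2
  rcases mul_eq_zero.1 h2 with h3 | h3
  · exact (mul_eq_zero.1 h3).resolve_left ha.ne'
  · exact absurd h3 (hr0 s hs)

/-- A profile curve of constant mean curvature that starts on the axis is a circle about a point of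
the axis. -/
lemma RegularProfile.deriv_z_one_eq (h : RegularProfile r z)
    (hu : ∀ s ∈ Ioc (0 : ℝ) 1, shiftedMean c r z s = 0) :
    r 1 * (deriv z 1 / speed r z 1) + c * r 1 ^ 2 = 0 := by
  have hw := h.speed_pos
  have hsin : ∀ s ∈ Icc (0 : ℝ) 1,
      HasDerivAt (fun x => deriv z x / speed r z x) (meridianCurv r z s * deriv r s) s := by
    intro s hs
    have hws := hw s hs
    have h1 := (h.hasDerivAt_deriv_z s).fun_div
      (hasDerivAt_speed (h.hasDerivAt_deriv_r s) (h.hasDerivAt_deriv_z s) hws) hws.ne'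
    refine h1.congr_deriv ?_
    rw [meridianCurv]
    field_simp
    rw [speed_sq]
    ring
  -- The derivative of this first integral is `2 r r' (H + c)` off the axis, and the integral itself
  -- starts from zero.
  have hder : ∀ s ∈ Icc (0 : ℝ) 1, HasDerivAt
      (fun x => r x * (deriv z x / speed r z x) + c * r x ^ 2)
      (deriv r s * (deriv z s / speed r z s) + r s * (meridianCurv r z s * deriv r s)
        + c * (2 * r s * deriv r s)) s := by
    intro s hs
    refine (((h.hasDerivAt_r s).fun_mul (hsin s hs)).fun_add
      (((h.hasDerivAt_r s).fun_pow 2).const_mul c)).congr_deriv ?_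
    push_cast
    ring
  have hzero : ∀ s ∈ Icc (0 : ℝ) 1, deriv r s * (deriv z s / speed r z s)
      + r s * (meridianCurv r z s * deriv r s) + c * (2 * r s * deriv r s) = 0 := by
    intro s hs
    rcases hs.1.eq_or_lt with rfl | h0
    · rw [h.r_zero, h.deriv_z_zero]
      ring
    · have h1 := hu s ⟨h0, hs.2⟩
      have hr := h.r_pos s ⟨h0, hs.2⟩
      have hws := hw s hs
      have h2 : parallelCurv r z s * r s = deriv z s / speed r z s := by
        rw [parallelCurv]
        field_simp
      rw [shiftedMean] at h1
      rw [← h2]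
      linear_combination 2 * r s * deriv r s * h1
  have hint := intervalIntegral.integral_eq_sub_of_hasDerivAt (a := 0) (b := 1)
    (f := fun x => r x * (deriv z x / speed r z x) + c * r x ^ 2) (f' := fun _ => 0)
    (fun s hs => by
      rw [uIcc_of_le zero_le_one] at hs
      exact (hder s hs).congr_deriv (hzero s hs)) intervalIntegrable_const
  rw [intervalIntegral.integral_zero, h.r_zero] at hint
  linear_combination -hint

lemma IsRevolutionDisc.shiftedMean_one_ne_zero (hF : IsRevolutionDisc F Q q r z)
    (h : RegularProfile r z) (ha : 0 < a) (hb : b ≠ 0) (hc : c ≠ 0)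
    (hcrit : IsCritical a c b α β F) (hρ : r 1 ^ 2 * β = α) : shiftedMean c r z 1 ≠ 0 := by
  intro h1
  have h2 := h.deriv_z_one_eq (hF.shiftedMean_eq_zero h ha hcrit hρ h1)
  have h3 := hF.natural_boundary h hcrit hρ
  have hr := h.r_pos 1 ⟨zero_lt_one, le_rfl⟩
  rw [momentum, h1, mul_zero, zero_mul, zero_add] at h3
  rw [(mul_eq_zero.1 h3).resolve_left hb, mul_zero, zero_add] at h2
  exact mul_ne_zero hc (pow_ne_zero 2 hr.ne') h2

/-- The boundary angle of a critical disc. -/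
lemma IsRevolutionDisc.boundary_angle (hF : IsRevolutionDisc F Q q r z)
    (h : RegularProfile r z) (ha : 0 < a) (hb : b ≠ 0) (hc : c ≠ 0)
    (hcrit : IsCritical a c b α β F) (hρ : r 1 ^ 2 * β = α) :
    (a + b) * (deriv z 1 / speed r z 1) = -(2 * a * c * r 1) := by
  have one_mem : (1 : ℝ) ∈ Ioc (0 : ℝ) 1 := ⟨zero_lt_one, le_rfl⟩
  have hu := (hF.shiftedMean_boundary h ha hcrit hρ).resolve_left
    (hF.shiftedMean_one_ne_zero h ha hb hc hcrit hρ)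
  have hn := hF.natural_boundary h hcrit hρ
  have hr := h.r_pos 1 one_mem
  have hw := h.speed_pos 1 (Ioc_subset_Icc_self one_mem)
  have h2 : parallelCurv r z 1 * r 1 = deriv z 1 / speed r z 1 := by
    rw [parallelCurv]
    field_simp
  have hud : shiftedMean c r z 1 = (meridianCurv r z 1 + parallelCurv r z 1) / 2 + c := rfl
  rw [momentum] at hn
  -- From `u = k₁` and `2u = k₁ + k₂ + 2c` follows `u = k₂ + 2c`, which is put into the natural
  -- condition, with `k₂ r = z'/w`.
  linear_combination hn - 2 * a * r 1 * hud + a * r 1 * hu - a * h2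

lemma RegularProfile.integral_bendingDensity_pos (h : RegularProfile r z) (ha : 0 < a)
    (h1 : shiftedMean c r z 1 ≠ 0) : 0 < ∫ s in (0 : ℝ)..1, bendingDensity a c r z s := by
  have hpos : ∀ s ∈ Ioc (0 : ℝ) 1, 0 ≤ bendingDensity a c r z s := fun s hs => by
    have := h.r_pos s hs
    have := h.speed_pos s (Ioc_subset_Icc_self hs)
    rw [bendingDensity]
    positivity
  have one_mem : (1 : ℝ) ∈ Ioc (0 : ℝ) 1 := ⟨zero_lt_one, le_rfl⟩
  have hone : 0 < bendingDensity a c r z 1 := by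
    have := h.r_pos 1 one_mem
    have := h.speed_pos 1 (Ioc_subset_Icc_self one_mem)
    rw [bendingDensity]
    positivity
  have hI := h.intervalIntegrable_bendingDensity a c
  have hhalf : 0 < ∫ s in (1 / 2 : ℝ)..1, bendingDensity a c r z s := by
    refine intervalIntegral.integral_pos (by norm_num)
      ((h.continuousOn_bendingDensity a c).mono fun s hs => ⟨by linarith [hs.1], hs.2⟩)
      (fun s hs => hpos s ⟨by linarith [hs.1], hs.2⟩) ⟨1, ⟨by norm_num, le_rfl⟩, hone⟩
  have hsub1 : uIcc (0 : ℝ) (1 / 2) ⊆ uIcc 0 1 := by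
    rw [uIcc_of_le (by norm_num), uIcc_of_le zero_le_one]
    exact Icc_subset_Icc_right (by norm_num)
  have hsub2 : uIcc (1 / 2 : ℝ) 1 ⊆ uIcc 0 1 := by
    rw [uIcc_of_le (by norm_num), uIcc_of_le zero_le_one]
    exact Icc_subset_Icc_left (by norm_num)
  rw [← intervalIntegral.integral_add_adjacent_intervals (hI.mono_set hsub1) (hI.mono_set hsub2)]
  refine add_pos_of_nonneg_of_pos ?_ hhalf
  rw [intervalIntegral.integral_of_le (by norm_num)]
  exact MeasureTheory.setIntegral_nonneg measurableSet_Ioc fun s hs =>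
    hpos s ⟨hs.1, hs.2.trans (by norm_num)⟩

end

/-! ### Spherical caps in stereographic coordinates -/

/-- The distance to the axis along the profile curve of a cap. -/
def capRadius (c k s : ℝ) : ℝ := 2 * k * s / (|c| * (1 + k ^ 2 * s ^ 2))

/-- The height along the profile curve of a cap. -/
def capHeight (c k s : ℝ) : ℝ := (1 - k ^ 2 * s ^ 2) / (c * (1 + k ^ 2 * s ^ 2))

/-- The cap of the sphere of radius `1 / |c|` about the origin that is the image of the unit disc
under the inverse stereographic projection, scaled by `k`. -/
def capMap (c k : ℝ) (p : ℝ × ℝ) : R3 :=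
  ![2 * k * p.1 / (|c| * (1 + k ^ 2 * (p.1 ^ 2 + p.2 ^ 2))),
    2 * k * p.2 / (|c| * (1 + k ^ 2 * (p.1 ^ 2 + p.2 ^ 2))),
    (1 - k ^ 2 * (p.1 ^ 2 + p.2 ^ 2)) / (c * (1 + k ^ 2 * (p.1 ^ 2 + p.2 ^ 2)))]

/-- The stereographic projection that inverts `capMap`. -/
def capProj (c k : ℝ) (x : R3) : ℝ × ℝ :=
  (|c| * x 0 / (k * (1 + c * x 2)), |c| * x 1 / (k * (1 + c * x 2)))

section

variable {c k : ℝ}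

lemma one_add_height (hc : c ≠ 0) (p : ℝ × ℝ) :
    1 + c * capMap c k p 2 = 2 / (1 + k ^ 2 * (p.1 ^ 2 + p.2 ^ 2)) := by
  have : 1 + k ^ 2 * (p.1 ^ 2 + p.2 ^ 2) ≠ 0 := by positivity
  simp only [capMap, Matrix.cons_val]
  field_simp
  ring

lemma capProj_capMap (hc : c ≠ 0) (hk : 0 < k) (p : ℝ × ℝ) : capProj c k (capMap c k p) = p := by
  have h1 : 1 + k ^ 2 * (p.1 ^ 2 + p.2 ^ 2) ≠ 0 := by positivity
  have h2 : |c| ≠ 0 := abs_ne_zero.2 hc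
  rw [capProj, one_add_height hc]
  simp only [capMap, Matrix.cons_val]
  ext <;> simp only <;> field_simp

lemma contDiff_capMap (hc : c ≠ 0) : ContDiff ℝ 4 (capMap c k) := by
  have h1 : ∀ p : ℝ × ℝ, 1 + k ^ 2 * (p.1 ^ 2 + p.2 ^ 2) ≠ 0 := fun p => by positivity
  have h2 : |c| ≠ 0 := abs_ne_zero.2 hc
  rw [contDiff_pi]
  intro i
  fin_cases i
  · exact ContDiff.div (by fun_prop) (by fun_prop) fun p => mul_ne_zero h2 (h1 p)
  · exact ContDiff.div (by fun_prop) (by fun_prop) fun p => mul_ne_zero h2 (h1 p)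
  · exact ContDiff.div (by fun_prop) (by fun_prop) fun p => mul_ne_zero hc (h1 p)

/-- Stereographic projection is a left inverse differentiable at the image points, so by the chain
rule the differential has a left inverse. -/
lemma isImmersedDisc_capMap (hc : c ≠ 0) (hk : 0 < k) : IsImmersedDisc (capMap c k) := by
  refine ⟨contDiff_capMap hc, fun p _ => ?_⟩
  have hG := ((contDiff_capMap (k := k) hc).differentiable (by norm_num) p).hasFDerivAt
  have hden : k * (1 + c * capMap c k p 2) ≠ 0 := by
    rw [one_add_height hc]
    positivity
  have hP : DifferentiableAt ℝ (fun x => capProj c k x) (capMap c k p) := by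
    have hd : DifferentiableAt ℝ (fun x : R3 => k * (1 + c * x 2)) (capMap c k p) := by fun_prop
    have hn : ∀ i, DifferentiableAt ℝ (fun x : R3 => |c| * x i) (capMap c k p) := by fun_prop
    simp only [capProj, div_eq_mul_inv]
    exact ((hn 0).fun_mul (hd.fun_inv hden)).prodMk ((hn 1).fun_mul (hd.fun_inv hden))
  have hcomp := hP.hasFDerivAt.comp p hG
  have hid : capProj c k ∘ capMap c k = id := funext (capProj_capMap hc hk)
  rw [hid] at hcomp
  have heq := hcomp.unique (hasFDerivAt_id p)
  refine Function.LeftInverse.injective (g := fderiv ℝ (capProj c k) (capMap c k p)) fun v => ?_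
  exact DFunLike.congr_fun heq v

lemma polar_capMap (c k s θ : ℝ) : polar (capMap c k) s θ =
    0 + (1 : Matrix (Fin 3) (Fin 3) ℝ) *ᵥ
      ![capRadius c k s * Real.cos θ, capRadius c k s * Real.sin θ, capHeight c k s] := by
  have h : (s * Real.cos θ) ^ 2 + (s * Real.sin θ) ^ 2 = s ^ 2 := by
    linear_combination s ^ 2 * Real.sin_sq_add_cos_sq θ
  rw [zero_add, Matrix.one_mulVec, polar, capMap]
  simp only [h, capRadius, capHeight]
  ext i
  fin_cases i <;> simp <;> ring

lemma isRevolutionDisc_capMap (hk : 0 < k) :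
    IsRevolutionDisc (capMap c k) 1 0 (capRadius c k) (capHeight c k) := by
  refine ⟨one_mem _, fun s hs => ?_, fun s _ θ => polar_capMap c k s θ⟩
  have := hs.1
  rw [capRadius]
  positivity

lemma hasDerivAt_capRadius (hc : c ≠ 0) (s : ℝ) : HasDerivAt (capRadius c k)
    (2 * k * (1 - k ^ 2 * s ^ 2) / (|c| * (1 + k ^ 2 * s ^ 2) ^ 2)) s := by
  have h1 : 1 + k ^ 2 * s ^ 2 ≠ 0 := by positivity
  have h2 : |c| ≠ 0 := abs_ne_zero.2 hc
  have h := ((hasDerivAt_id s).const_mul (2 * k)).fun_div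
    (((((hasDerivAt_id s).fun_pow 2).const_mul (k ^ 2)).const_add 1).const_mul |c|)
    (mul_ne_zero h2 h1)
  refine h.congr_deriv ?_
  simp only [id]
  field_simp
  push_cast
  ring

lemma hasDerivAt_capHeight (hc : c ≠ 0) (s : ℝ) : HasDerivAt (capHeight c k)
    (-(4 * k ^ 2 * s) / (c * (1 + k ^ 2 * s ^ 2) ^ 2)) s := by
  have h1 : 1 + k ^ 2 * s ^ 2 ≠ 0 := by positivity
  have h := ((((hasDerivAt_id s).fun_pow 2).const_mul (k ^ 2)).const_sub 1).fun_div
    (((((hasDerivAt_id s).fun_pow 2).const_mul (k ^ 2)).const_add 1).const_mul c)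
    (mul_ne_zero hc h1)
  refine h.congr_deriv ?_
  simp only [id]
  field_simp
  push_cast
  ring

lemma deriv_capRadius (hc : c ≠ 0) : deriv (capRadius c k) = fun s =>
    2 * k * (1 - k ^ 2 * s ^ 2) / (|c| * (1 + k ^ 2 * s ^ 2) ^ 2) :=
  funext fun s => (hasDerivAt_capRadius hc s).deriv

lemma deriv_capHeight (hc : c ≠ 0) : deriv (capHeight c k) = fun s =>
    -(4 * k ^ 2 * s) / (c * (1 + k ^ 2 * s ^ 2) ^ 2) :=
  funext fun s => (hasDerivAt_capHeight hc s).deriv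

lemma deriv2_capRadius (hc : c ≠ 0) (s : ℝ) : deriv (deriv (capRadius c k)) s =
    4 * k ^ 3 * s * (k ^ 2 * s ^ 2 - 3) / (|c| * (1 + k ^ 2 * s ^ 2) ^ 3) := by
  have h1 : 1 + k ^ 2 * s ^ 2 ≠ 0 := by positivity
  have h2 : |c| ≠ 0 := abs_ne_zero.2 hc
  have h := (((((hasDerivAt_id s).fun_pow 2).const_mul (k ^ 2)).const_sub 1).const_mul
    (2 * k)).fun_div
    ((((((hasDerivAt_id s).fun_pow 2).const_mul (k ^ 2)).const_add 1).fun_pow 2).const_mul |c|)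
    (mul_ne_zero h2 (pow_ne_zero 2 h1))
  rw [deriv_capRadius hc]
  refine (h.congr_deriv ?_).deriv
  simp only [id]
  field_simp
  push_cast
  ring

lemma deriv2_capHeight (hc : c ≠ 0) (s : ℝ) : deriv (deriv (capHeight c k)) s =
    4 * k ^ 2 * (3 * k ^ 2 * s ^ 2 - 1) / (c * (1 + k ^ 2 * s ^ 2) ^ 3) := by
  have h1 : 1 + k ^ 2 * s ^ 2 ≠ 0 := by positivity
  have h := (((hasDerivAt_id s).const_mul (4 * k ^ 2)).fun_neg).fun_div
    ((((((hasDerivAt_id s).fun_pow 2).const_mul (k ^ 2)).const_add 1).fun_pow 2).const_mul c)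
    (mul_ne_zero hc (pow_ne_zero 2 h1))
  rw [deriv_capHeight hc]
  refine (h.congr_deriv ?_).deriv
  simp only [id]
  field_simp
  push_cast
  ring

lemma speed_cap (hc : c ≠ 0) (hk : 0 < k) (s : ℝ) :
    speed (capRadius c k) (capHeight c k) s = 2 * k / (|c| * (1 + k ^ 2 * s ^ 2)) := by
  have h1 : 1 + k ^ 2 * s ^ 2 ≠ 0 := by positivity
  have h2 : |c| ≠ 0 := abs_ne_zero.2 hc
  rw [speed, deriv_capRadius hc, deriv_capHeight hc]
  rw [← Real.sqrt_sq (by positivity : 0 ≤ 2 * k / (|c| * (1 + k ^ 2 * s ^ 2)))]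
  congr 1
  simp only [div_pow, mul_pow, sq_abs]
  field_simp
  ring

lemma regularProfile_cap (hc : c ≠ 0) (hk : 0 < k) :
    RegularProfile (capRadius c k) (capHeight c k) := by
  have h1 : ∀ s : ℝ, 1 + k ^ 2 * s ^ 2 ≠ 0 := fun s => by positivity
  have h2 : |c| ≠ 0 := abs_ne_zero.2 hc
  refine ⟨?_, ?_, ?_, ?_, ?_, fun s hs => ?_, fun s _ => ?_⟩
  · exact ContDiff.div (by fun_prop) (by fun_prop) fun s => mul_ne_zero h2 (h1 s)
  · exact ContDiff.div (by fun_prop) (by fun_prop) fun s => mul_ne_zero hc (h1 s)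
  · simp [capRadius]
  · rw [deriv_capRadius hc]
    simp only
    norm_num
    positivity
  · rw [deriv_capHeight hc]
    simp
  · have := hs.1
    rw [capRadius]
    positivity
  · rw [speed_cap hc hk]
    positivity

/-- The height carries `c` and the radius `|c|`: for `c < 0` the cap is reflected, which reverses
its normal relative to the sphere, and the curvature is `-c` for either sign. -/
lemma meridianCurv_cap (hc : c ≠ 0) (hk : 0 < k) (s : ℝ) :
    meridianCurv (capRadius c k) (capHeight c k) s = -c := by
  have h1 : 1 + k ^ 2 * s ^ 2 ≠ 0 := by positivity
  have h2 : |c| ≠ 0 := abs_ne_zero.2 hc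
  rw [meridianCurv, speed_cap hc hk, deriv2_capRadius hc, deriv2_capHeight hc, deriv_capRadius hc,
    deriv_capHeight hc]
  field_simp
  rw [sq_abs]
  ring

lemma parallelCurv_cap (hc : c ≠ 0) (hk : 0 < k) {s : ℝ} (hs : 0 < s) :
    parallelCurv (capRadius c k) (capHeight c k) s = -c := by
  have h1 : 1 + k ^ 2 * s ^ 2 ≠ 0 := by positivity
  have h2 : |c| ≠ 0 := abs_ne_zero.2 hc
  rw [parallelCurv, speed_cap hc hk, deriv_capHeight hc, capRadius]
  field_simp
  rw [sq_abs]
  ring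

lemma meanCurvature_cap (hc : c ≠ 0) (hk : 0 < k) {s : ℝ} (hs : 0 < s) (θ : ℝ) :
    meanCurvature (polar (capMap c k)) s θ = -c := by
  have hp := regularProfile_cap hc hk
  have hr : 0 < capRadius c k s := by
    rw [capRadius]
    positivity
  have hw : 0 < speed (capRadius c k) (capHeight c k) s := by
    rw [speed_cap hc hk]
    positivity
  have hX : RevolutionNear (polar (capMap c k)) 1 0 (capRadius c k) (capHeight c k) s :=
    Eventually.of_forall fun x θ => polar_capMap c k x θ
  rw [hX.meanCurvature_eq (one_mem _) (hp.contDiff_r.of_le (by norm_num)).contDiffAt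
    (hp.contDiff_z.of_le (by norm_num)).contDiffAt hr hw, meridianCurv_cap hc hk,
    parallelCurv_cap hc hk hs]
  ring

lemma energy_cap (hc : c ≠ 0) (hk : 0 < k) (a b α β : ℝ) :
    energy a c b α β (capMap c k) =
      2 * Real.pi * b * (1 - (1 - k ^ 2) / (1 + k ^ 2))
      + 2 * Real.pi * ((α * (1 / capRadius c k 1) ^ 2 + β) * capRadius c k 1) := by
  have h0 : ∫ s in (0 : ℝ)..1, bendingDensity a c (capRadius c k) (capHeight c k) s = 0 := by
    rw [intervalIntegral.integral_congr_Ioo_of_le (g := fun _ => 0) zero_le_one,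
      intervalIntegral.integral_zero]
    intro s hs
    rw [bendingDensity, shiftedMean, meridianCurv_cap hc hk, parallelCurv_cap hc hk hs.1]
    ring
  have h1 : deriv (capRadius c k) 1 / speed (capRadius c k) (capHeight c k) 1 =
      (1 - k ^ 2) / (1 + k ^ 2) := by
    have h2 : |c| ≠ 0 := abs_ne_zero.2 hc
    rw [speed_cap hc hk, deriv_capRadius hc]
    simp only [one_pow, mul_one]
    field_simp
  rw [(isRevolutionDisc_capMap hk).energy_eq (regularProfile_cap hc hk), h0, h1]
  ring

lemma isSphericalCap_capMap (hc : c ≠ 0) (hk : 0 < k) : IsSphericalCap (capMap c k) (1 / |c|) := by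
  have he : 0 < |c| := abs_pos.2 hc
  have hee : |c| ^ 2 = c ^ 2 := sq_abs c
  refine ⟨(Function.LeftInverse.injective (capProj_capMap hc hk)).injOn,
    0, ![0, 0, |c| / c], (1 - k ^ 2) / (|c| * (1 + k ^ 2)), ?_, ?_, ?_, ?_⟩
  · simp [dotProduct, Fin.sum_univ_three]
    field_simp
    rw [hee]
  · rw [← sub_pos]
    have : (1 - k ^ 2) / (|c| * (1 + k ^ 2)) - -(1 / |c|) = 2 / (|c| * (1 + k ^ 2)) := by
      field_simp
      ring
    rw [this]
    positivity
  · rw [← sub_pos]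
    have : 1 / |c| - (1 - k ^ 2) / (|c| * (1 + k ^ 2)) = 2 * k ^ 2 / (|c| * (1 + k ^ 2)) := by
      field_simp
      ring
    rw [this]
    positivity
  · ext x
    simp only [mem_image, mem_ofPred_eq, sub_zero, dotProduct, Fin.sum_univ_three,
      Matrix.cons_val_zero, Matrix.cons_val_one, Matrix.cons_val, mul_zero, zero_add]
    constructor
    · rintro ⟨p, hp, rfl⟩
      have h1 : 0 < 1 + k ^ 2 * (p.1 ^ 2 + p.2 ^ 2) := by positivity
      simp only [disc, mem_ofPred_eq] at hp
      simp only [capMap, Matrix.cons_val_zero, Matrix.cons_val_one, Matrix.cons_val]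
      constructor
      · field_simp
        rw [hee]
        field_simp
        ring
      · have h2 : (1 - k ^ 2 * (p.1 ^ 2 + p.2 ^ 2)) / (c * (1 + k ^ 2 * (p.1 ^ 2 + p.2 ^ 2)))
            * (|c| / c) - (1 - k ^ 2) / (|c| * (1 + k ^ 2)) =
            2 * k ^ 2 * (1 - (p.1 ^ 2 + p.2 ^ 2)) /
              (|c| * (1 + k ^ 2) * (1 + k ^ 2 * (p.1 ^ 2 + p.2 ^ 2))) := by
          field_simp
          rw [hee]
          ring
        rw [← sub_nonneg, h2]
        have : 0 ≤ 1 - (p.1 ^ 2 + p.2 ^ 2) := by linarith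
        positivity
    · rintro ⟨hx, hh⟩
      have hy : (1 - k ^ 2) / (1 + k ^ 2) ≤ c * x 2 := by
        have h3 : x 2 * (|c| / c) = c * x 2 / |c| := by
          field_simp
          rw [hee]
        rw [h3, le_div_iff₀ he] at hh
        refine le_trans (le_of_eq ?_) hh
        field_simp
      have hy1 : 0 < 1 + c * x 2 := by
        have : (1 - k ^ 2) / (1 + k ^ 2) = 2 / (1 + k ^ 2) - 1 := by
          field_simp
          ring
        have h4 : 0 < 2 / (1 + k ^ 2) := by positivity
        linarith
      have hx' : c ^ 2 * (x 0 * x 0 + x 1 * x 1) = 1 - (c * x 2) ^ 2 := by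
        have h5 : c ^ 2 * (1 / |c|) ^ 2 = 1 := by
          rw [div_pow, hee]
          field_simp
        linear_combination c ^ 2 * hx + h5
      -- Under stereographic projection the squared parameter radius decreases with `c * x 2`, so
      -- the height condition is exactly membership in the unit disc.
      have hrho : (capProj c k x).1 ^ 2 + (capProj c k x).2 ^ 2 =
          (1 - c * x 2) / (k ^ 2 * (1 + c * x 2)) := by
        simp only [capProj, div_pow, mul_pow, hee]
        field_simp
        linear_combination hx'
      have hden : 1 + k ^ 2 * ((capProj c k x).1 ^ 2 + (capProj c k x).2 ^ 2) =
          2 / (1 + c * x 2) := by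
        rw [hrho]
        field_simp
        ring
      refine ⟨capProj c k x, ?_, ?_⟩
      · simp only [disc, mem_ofPred_eq]
        rw [hrho, div_le_one (by positivity)]
        rw [div_le_iff₀ (by positivity)] at hy
        linarith
      · have hnum : 1 - k ^ 2 * ((capProj c k x).1 ^ 2 + (capProj c k x).2 ^ 2) =
            2 * (c * x 2) / (1 + c * x 2) := by
          rw [hrho]
          field_simp
          ring
        rw [capMap, hden, hnum]
        ext i
        fin_cases i <;> simp [capProj] <;> field_simp

/-- The cap through a given circle, with a prescribed cosine of the contact angle. -/
lemma exists_cap_parameter (hc : c ≠ 0) {ρ C : ℝ} (hρ : 0 < ρ) (hC : C ^ 2 = 1 - c ^ 2 * ρ ^ 2)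
    (hC1 : 0 < 1 + C) : ∃ k, 0 < k ∧ capRadius c k 1 = ρ ∧ (1 - k ^ 2) / (1 + k ^ 2) = C := by
  have he : 0 < |c| := abs_pos.2 hc
  -- With `C` as cosine and `|c| * ρ` as sine of the contact angle, `|c| * ρ / (1 + C)` is the
  -- tangent of half the angle.
  have hk2 : (|c| * ρ / (1 + C)) ^ 2 = (1 - C) / (1 + C) := by
    rw [div_pow, mul_pow, sq_abs]
    field_simp
    linear_combination hC
  have h1 : 1 + (|c| * ρ / (1 + C)) ^ 2 = 2 / (1 + C) := by
    rw [hk2]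
    field_simp
    ring
  have h2 : 1 - (|c| * ρ / (1 + C)) ^ 2 = 2 * C / (1 + C) := by
    rw [hk2]
    field_simp
    ring
  refine ⟨|c| * ρ / (1 + C), by positivity, ?_, ?_⟩
  · rw [capRadius, one_pow, mul_one, mul_one, h1]
    field_simp
  · rw [h1, h2]
    field_simp

end

end EulerHelfrich

end

/-! ### Comparison of the critical disc with a cap -/

theorem mainTheorem12 (a c b α β : ℝ) (ha : 0 < a) (hα : 0 < α) (hβ : 0 < β)
    (hc : c ≠ 0) (hb : b ≠ 0) (hb1 : -3 * a ≤ b) (hb2 : b ≤ a)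
    (F : ℝ × ℝ → EulerHelfrich.R3)
    (hF : EulerHelfrich.IsImmersedDisc F)
    (hcrit : EulerHelfrich.IsCritical a c b α β F)
    (hsymm : EulerHelfrich.IsAxiallySymmetricWithRadius F (√(α / β))) :
    (∃ G : ℝ × ℝ → EulerHelfrich.R3,
      EulerHelfrich.IsImmersedDisc G ∧
      EulerHelfrich.IsAxiallySymmetricWithRadius G (√(α / β)) ∧
      EulerHelfrich.IsSphericalCap G (1 / |c|) ∧
      (∀ s ∈ Set.Ioc (0 : ℝ) 1, ∀ θ : ℝ,
        EulerHelfrich.meanCurvature (EulerHelfrich.polar G) s θ = -c) ∧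
      EulerHelfrich.energy a c b α β G < EulerHelfrich.energy a c b α β F) ∧
    ¬ EulerHelfrich.MinimizesAmongAxiallySymmetric a c b α β F := by
  have main : ∃ G : ℝ × ℝ → EulerHelfrich.R3,
      EulerHelfrich.IsImmersedDisc G ∧
      EulerHelfrich.IsAxiallySymmetricWithRadius G (√(α / β)) ∧
      EulerHelfrich.IsSphericalCap G (1 / |c|) ∧
      (∀ s ∈ Set.Ioc (0 : ℝ) 1, ∀ θ : ℝ,
        EulerHelfrich.meanCurvature (EulerHelfrich.polar G) s θ = -c) ∧
      EulerHelfrich.energy a c b α β G < EulerHelfrich.energy a c b α β F := by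
    obtain ⟨Q, q, r₀, z₀, hrev₀, hr₀⟩ := hsymm
    obtain ⟨r, z, hp, hrev, hr⟩ := hrev₀.exists_regularProfile hF
    rw [hr₀] at hr
    have hρ0 : 0 < √(α / β) := Real.sqrt_pos.2 (by positivity)
    have hρ : r 1 ^ 2 * β = α := by
      rw [hr, Real.sq_sqrt (by positivity)]
      field_simp
    have hangle := hrev.boundary_angle hp ha hb hc hcrit hρ
    have hpos := hp.integral_bendingDensity_pos ha
      (hrev.shiftedMean_one_ne_zero hp ha hb hc hcrit hρ)
    have hw := hp.speed_pos 1 ⟨zero_le_one, le_rfl⟩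
    have hunit : (deriv r 1 / EulerHelfrich.speed r z 1) ^ 2
        + (deriv z 1 / EulerHelfrich.speed r z 1) ^ 2 = 1 := by
      rw [div_pow, div_pow, ← add_div, ← EulerHelfrich.speed_sq, div_self (by positivity)]
    have henergy := hrev.energy_eq hp a c b α β
    set S := deriv z 1 / EulerHelfrich.speed r z 1
    set CX := deriv r 1 / EulerHelfrich.speed r z 1
    set ρ := √(α / β)
    rw [hr] at hangle henergy
    -- The hypotheses on `b` are used here, in the form `|a + b| ≤ 2a`.
    have hS : c ^ 2 * ρ ^ 2 ≤ S ^ 2 := by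
      have h1 : (a + b) ^ 2 * S ^ 2 = (2 * a) ^ 2 * (c ^ 2 * ρ ^ 2) := by
        linear_combination ((a + b) * S - 2 * a * c * ρ) * hangle
      have h2 : (a + b) ^ 2 ≤ (2 * a) ^ 2 := sq_le_sq' (by linarith) (by linarith)
      have h3 : (2 * a) ^ 2 * (c ^ 2 * ρ ^ 2) ≤ (2 * a) ^ 2 * S ^ 2 := by
        rw [← h1]
        exact mul_le_mul_of_nonneg_right h2 (sq_nonneg S)
      exact le_of_mul_le_mul_left h3 (by positivity)
    have hCX : CX ^ 2 ≤ 1 - c ^ 2 * ρ ^ 2 := by linarith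
    -- The existence of the critical disc forces the circle to fit on the sphere.
    have hm : 0 ≤ 1 - c ^ 2 * ρ ^ 2 := (sq_nonneg CX).trans hCX
    set m := √(1 - c ^ 2 * ρ ^ 2) with hmd
    have hm2 : m ^ 2 = 1 - c ^ 2 * ρ ^ 2 := Real.sq_sqrt hm
    have hm0 : 0 ≤ m := Real.sqrt_nonneg _
    have hm1 : m < 1 := by
      have : 0 < c ^ 2 * ρ ^ 2 := by positivity
      nlinarith
    have habs : |CX| ≤ m := Real.abs_le_sqrt hCX
    -- For `b > 0` the cap with cosine `m ≥ 0` is taken, for `b < 0` its complement. Since `c` and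
    -- `ρ` are nonzero, `m < 1`, so `1 + C > 0` in both cases.
    obtain ⟨C, hC2, hC1, hbC⟩ : ∃ C, C ^ 2 = 1 - c ^ 2 * ρ ^ 2 ∧ 0 < 1 + C ∧ b * CX ≤ b * C := by
      have h1 := abs_le.1 habs
      rcases lt_or_gt_of_ne hb with hneg | hpos
      · exact ⟨-m, by rw [neg_sq, hm2], by linarith, mul_le_mul_of_nonpos_left h1.1 hneg.le⟩
      · exact ⟨m, hm2, by linarith, mul_le_mul_of_nonneg_left h1.2 hpos.le⟩
    obtain ⟨k, hk, hkρ, hkC⟩ := EulerHelfrich.exists_cap_parameter hc hρ0 hC2 hC1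
    refine ⟨EulerHelfrich.capMap c k, EulerHelfrich.isImmersedDisc_capMap hc hk,
      ⟨1, 0, _, _, EulerHelfrich.isRevolutionDisc_capMap hk, hkρ⟩,
      EulerHelfrich.isSphericalCap_capMap hc hk,
      fun s hs θ => EulerHelfrich.meanCurvature_cap hc hk hs.1 θ, ?_⟩
    rw [EulerHelfrich.energy_cap hc hk, hkρ, hkC, henergy]
    -- Strictness comes from the bending energy alone; the Gauss–Bonnet terms give only a weak
    -- inequality.
    have h1 : 0 < 2 * Real.pi * ∫ s in (0 : ℝ)..1, EulerHelfrich.bendingDensity a c r z s := by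
      positivity
    have h2 := mul_le_mul_of_nonneg_left hbC (by positivity : 0 ≤ 2 * Real.pi)
    linarith
  refine ⟨main, fun hmin => ?_⟩
  obtain ⟨G, hG, ⟨Q, q, r, z, hrev, -⟩, -, -, hlt⟩ := main
  exact absurd (hmin G hG ⟨Q, q, r, z, hrev⟩) (not_le.2 hlt)
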